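/- Let $\gamma\subset\mathbb C$ be a smooth Jordan curve (the image of a smooth embedding $\mathbb R/\mathbb Z\to\mathbb C$). On $\mathbb C^2$, with coordinates $z=x+iy$ and $w=re^{i\theta}$, take the symplectic form $\omega=dx\wedge dy+r\,dr\wedge d\theta$. Put $l(z,w)=\left(\frac{z+w}2,\frac{z-w}2\right)$ and $L=l(\gamma\times\gamma)$, and for $\phi\in\mathbb R$ let $R_\phi(z,w)=(z,e^{i\phi}w)$. Let $L_\phi$ be either $R_\phi(L)$ for a constant $\phi\in(0,\pi/2]$, or $S_\phi(L)$ with $S_\phi(z,w)=(z,e^{i\phi(2|w|)}w)$ for a smooth function $\phi:[0,\infty)\to(0,\pi)$. Then one may remove an arbitrarily small neighborhood of $\gamma\times\{0\}$ in $L\cup L_\phi$ and replace it with two disjoint Lagrangian annuli so as to obtain a smoothly immersed Lagrangian torus $T$ with $R_\pi(T)=T$ and $T\cap(\mathbb C\times\{0\})=\emptyset$. Precisely: for every open $U\supseteq\gamma\times\{0\}$ there are an open set $N$ with $\gamma\times\{0\}\subseteq N\subseteq U$ and $R_\pi(N)=N$, and a smooth Lagrangian immersion $f:\mathbb R/\mathbb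 Z\times\mathbb R/\mathbb Z\to\mathbb C^2$ with image $T$, such that 1. $f$ maps the annulus $\mathbb R/\mathbb Z\times[\frac14,\frac12]$ bijectively onto $L\setminus N$, and the annulus $\mathbb R/\mathbb Z\times[\frac34,1]$ bijectively onto $L_\phi\setminus N$; 2. $f$ maps the two open annuli $\mathbb R/\mathbb Z\times(0,\frac14)$ and $\mathbb R/\mathbb Z\times(\frac12,\frac34)$ into $N$, and $f$ is injective on the union of the closed annuli $\mathbb R/\mathbb Z\times[0,\frac14]$ and $\mathbb R/\mathbb Z\times[\frac12,\frac34]$ (so their images are two disjoint embedded Lagrangian annuli); 3. $R_\pi(T)=T$ and $T\cap(\mathbb C\times\{0\})=\emptyset$. -/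

import Mathlib

open scoped ContDiff

noncomputable section

namespace RectPeg

/-- The standard symplectic form `dx ∧ dy + r dr ∧ dθ` on `ℂ²`. -/
def omega (a b : ℂ × ℂ) : ℝ :=
  (a.1.re * b.1.im - a.1.im * b.1.re) + (a.2.re * b.2.im - a.2.im * b.2.re)

/-- A smooth Jordan curve: the image of a smooth embedding of the circle `ℝ / ℤ` in the plane. -/
def IsSmoothJordanCurve (γ : Set ℂ) : Prop :=
  ∃ c : UnitAddCircle → ℂ, Function.Injective c ∧
    ContDiff ℝ ∞ (fun t : ℝ => c (t : UnitAddCircle)) ∧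
    (∀ t : ℝ, deriv (fun t : ℝ => c (t : UnitAddCircle)) t ≠ 0) ∧
    Set.range c = γ

/-- The linear map `(z, w) ↦ ((z + w) / 2, (z - w) / 2)`. -/
def l (p : ℂ × ℂ) : ℂ × ℂ := ((p.1 + p.2) / 2, (p.1 - p.2) / 2)

/-- The torus `L = l(γ × γ)`. -/
def torusL (γ : Set ℂ) : Set (ℂ × ℂ) := l '' (γ ×ˢ γ)

/-- The rotation `(z, r, θ) ↦ (z, r, θ + φ)`, where `w = r e^{iθ}`. -/
def R (φ : ℝ) (p : ℂ × ℂ) : ℂ × ℂ := (p.1, Complex.exp (φ * Complex.I) * p.2)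

/-- The map `(z, r, θ) ↦ (z, r, θ + φ(2r))`, where `w = r e^{iθ}`. -/
def S (φ : ℝ → ℝ) (p : ℂ × ℂ) : ℂ × ℂ :=
  (p.1, Complex.exp (φ (2 * ‖p.2‖) * Complex.I) * p.2)

/-- `L_φ` is either `R_φ(L)` for an angle `φ ∈ (0, π/2]`, or `S_φ(L)` for a smooth function
`φ : [0, ∞) → (0, π)`. -/
def IsRotatedTorus (γ : Set ℂ) (Lφ : Set (ℂ × ℂ)) : Prop :=
  (∃ φ : ℝ, 0 < φ ∧ φ ≤ Real.pi / 2 ∧ Lφ = R φ '' torusL γ) ∨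
  (∃ φ : ℝ → ℝ, ContDiffOn ℝ ∞ φ (Set.Ici 0) ∧
    (∀ r : ℝ, 0 ≤ r → φ r ∈ Set.Ioo 0 Real.pi) ∧ Lφ = S φ '' torusL γ)

/-- The torus `ℝ² / ℤ²`. -/
abbrev Torus : Type := UnitAddCircle × UnitAddCircle

/-- The lift of a map on `ℝ² / ℤ²` to `ℝ²`. -/
def lift (f : Torus → ℂ × ℂ) (p : ℝ × ℝ) : ℂ × ℂ :=
  f ((p.1 : UnitAddCircle), (p.2 : UnitAddCircle))

/-- `f` is a smooth Lagrangian immersion of the torus `ℝ² / ℤ²` in `ℂ²`. The covering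
`ℝ² → ℝ² / ℤ²` is a local diffeomorphism, so all conditions are read off on the lift. -/
def IsLagrangianImmersion (f : Torus → ℂ × ℂ) : Prop :=
  ContDiff ℝ ∞ (lift f) ∧
  (∀ p : ℝ × ℝ, Function.Injective (fderiv ℝ (lift f) p)) ∧
  ∀ p a b : ℝ × ℝ, omega (fderiv ℝ (lift f) p a) (fderiv ℝ (lift f) p b) = 0

/-- The annulus `(ℝ / ℤ) × I` in the torus, for a set `I` of reals taken modulo 1. -/
def annulus (I : Set ℝ) : Set Torus :=
  Set.univ ×ˢ ((fun t : ℝ => (t : UnitAddCircle)) '' I)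

end RectPeg

end

noncomputable section

namespace RectPeg

open Set Filter Topology

/-! ### The smooth step: strict monotonicity and nonvanishing slope -/

section Transition
open Real

/-! Off the diagonal, a point of `L` is the pair (midpoint, half chord) of the chord joining `c (x +
s)` and `c (x - s)`, with `x` modulo `1` and `0 < s < 1/2`. Hence `L` minus the diagonal is an open
annulus whose two ends lie over `γ × {0}`, and exchanging end points, `(x, s) ↦ (x + 1/2, 1/2 - s)`,
realizes `R_π` and swaps the ends. The torus runs along `L` from one end to the other, is turned
there onto `L_φ` by a cap in which `w` rotates, runs back along `L_φ`, and is turned back onto `L`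
by a second cap, the `R_π`-image of the first.

Rotating the `w` coordinate of `L` by an angle `α` adds `d(|w|²/2) ∧ dα` to the vanishing
restriction of `ω`. So `s` is replaced by a label (`IsCollar.slice`) whose level curves are curves
of constant `|w|` near both ends; a cap is then a U-turn in the plane of label and angle, times the
circle of `x`. Where the fraction of rotation varies, `|w|` depends on `y` alone
(`exists_dot_dfiber`); elsewhere `α` is a function of `|w|`. Either way the added form is zero.

Short chords are almost tangent to `γ` (`exists_tangency`). Therefore, at a small scale `ε`, `|w|`
is a coordinate near each end, and along a curve of constant `|w|` the midpoint advances in the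
direction of the nearby tangent (`dot_deriv_pos`). This makes the caps immersed at their turning
points, where the label is stationary, and embedded (`mid_slice_injective`). The rotation angles lie
in `[0, π)`, so a cap cannot meet its `R_π`-image; the label stays away from the two ends, so `w`
never vanishes. -/

theorem smoothTransition_eq_inv {x : ℝ} (h0 : 0 < x) (h1 : x < 1) :
    smoothTransition x = (1 + exp (x⁻¹ - (1 - x)⁻¹))⁻¹ := by
  have h2 : ¬ (1 - x ≤ 0) := by linarith
  rw [smoothTransition, expNegInvGlue, expNegInvGlue, if_neg (not_le.2 h0), if_neg h2, exp_sub,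
    exp_neg, exp_neg]
  have := exp_pos x⁻¹
  have := exp_pos (1 - x)⁻¹
  field_simp

/-- On the open interval the exponent `1/x - 1/(1 - x)` is strictly decreasing. Strictness is what
lets the rotation angle determine the position on a cap. -/
theorem smoothTransition_strictMonoOn : StrictMonoOn smoothTransition (Icc 0 1) := by
  intro x hx y hy hxy
  rcases hx.1.eq_or_lt with rfl | hx0
  · rw [smoothTransition.zero]
    exact smoothTransition.pos_of_pos hxy
  rcases hy.2.eq_or_lt with rfl | hy1
  · rw [smoothTransition.one]
    exact smoothTransition.lt_one_of_lt_one hxy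
  rw [smoothTransition_eq_inv hx0 (hxy.trans hy1), smoothTransition_eq_inv (hx0.trans hxy) hy1]
  have h1 : y⁻¹ < x⁻¹ := inv_strictAnti₀ hx0 hxy
  have h2 : (1 - x)⁻¹ < (1 - y)⁻¹ := inv_strictAnti₀ (by linarith) (by linarith)
  have h3 : exp (y⁻¹ - (1 - y)⁻¹) < exp (x⁻¹ - (1 - x)⁻¹) := exp_lt_exp.2 (by linarith)
  exact inv_strictAnti₀ (by positivity) (by linarith)

theorem differentiable_smoothTransition : Differentiable ℝ smoothTransition :=
  (smoothTransition.contDiff (n := 1)).differentiable (by norm_num)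

/-- Needed at the turning point of a cap: the label is stationary there, so the motion in `y` must
come from the rotation. -/
theorem deriv_smoothTransition_half_ne_zero : deriv smoothTransition (1 / 2) ≠ 0 := by
  have hev : smoothTransition =ᶠ[𝓝 (1 / 2)] fun x => (1 + exp (x⁻¹ - (1 - x)⁻¹))⁻¹ := by
    filter_upwards [Ioo_mem_nhds (a := (0 : ℝ)) (b := 1) (x := 1 / 2) (by norm_num) (by norm_num)]
      with x hx using smoothTransition_eq_inv hx.1 hx.2
  have h1 : HasDerivAt (fun x : ℝ => x⁻¹) (-(((1 : ℝ) / 2) ^ 2)⁻¹) (1 / 2) :=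
    hasDerivAt_inv (by norm_num)
  have h2 : HasDerivAt (fun x : ℝ => (1 - x)⁻¹) (-(-1) / (1 - 1 / 2) ^ 2) (1 / 2 : ℝ) :=
    ((hasDerivAt_id (1 / 2 : ℝ)).const_sub 1).inv (by norm_num)
  have h3 := (((h1.sub h2).exp).const_add 1).inv (by positivity)
  have h4 := h3.congr_of_eventuallyEq hev
  rw [h4.deriv]
  norm_num

theorem deriv_smoothTransition_of_nonpos {x : ℝ} (hx : x ≤ 0) : deriv smoothTransition x = 0 := by
  apply IsLocalMin.deriv_eq_zero
  filter_upwards with y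
  rw [smoothTransition.zero_of_nonpos hx]
  exact smoothTransition.nonneg y

theorem deriv_smoothTransition_of_one_le {x : ℝ} (hx : 1 ≤ x) : deriv smoothTransition x = 0 := by
  apply IsLocalMax.deriv_eq_zero
  filter_upwards with y
  rw [smoothTransition.one_of_one_le hx]
  exact smoothTransition.le_one y

end Transition

/-! ### Interpolation between chord length and parameter distance -/

/-- A smooth cutoff function, equal to `1` on `(-∞, 5/4]` and to `0` on `[2, ∞)`. -/
def cutoff (q : ℝ) : ℝ := Real.smoothTransition ((2 - q) * (4 / 3))

theorem cutoff_of_le {q : ℝ} (h : q ≤ 5 / 4) : cutoff q = 1 :=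
  Real.smoothTransition.one_of_one_le (by linarith)

theorem cutoff_of_ge {q : ℝ} (h : 2 ≤ q) : cutoff q = 0 :=
  Real.smoothTransition.zero_of_nonpos (by linarith)

theorem cutoff_nonneg (q : ℝ) : 0 ≤ cutoff q := Real.smoothTransition.nonneg _

theorem cutoff_le_one (q : ℝ) : cutoff q ≤ 1 := Real.smoothTransition.le_one _

theorem contDiff_cutoff : ContDiff ℝ ∞ cutoff :=
  Real.smoothTransition.contDiff.comp (by fun_prop)

theorem antitone_cutoff : Antitone cutoff := fun a b h =>
  Real.smoothTransition.monotone (by linarith)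

theorem hasDerivAt_cutoff (q : ℝ) : HasDerivAt cutoff (deriv cutoff q) q :=
  (contDiff_cutoff.differentiable (by simp) q).hasDerivAt

theorem deriv_cutoff_nonpos (q : ℝ) : deriv cutoff q ≤ 0 := antitone_cutoff.deriv_nonpos

theorem deriv_cutoff_of_ge {q : ℝ} (h : 2 ≤ q) : deriv cutoff q = 0 := by
  apply IsLocalMin.deriv_eq_zero
  filter_upwards with y
  rw [cutoff_of_ge h]
  exact cutoff_nonneg y

/-- Interpolation between `q` (where `q ≤ 5/4`) and `2 + s` (where `q ≥ 2`). -/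
def blend (q s : ℝ) : ℝ := cutoff q * q + (1 - cutoff q) * (2 + s)

theorem blend_of_le {q : ℝ} (h : q ≤ 5 / 4) (s : ℝ) : blend q s = q := by
  simp [blend, cutoff_of_le h]

theorem blend_of_ge {q : ℝ} (h : 2 ≤ q) (s : ℝ) : blend q s = 2 + s := by
  simp [blend, cutoff_of_ge h]

theorem lt_blend {a q s : ℝ} (ha : a < q) (ha2 : a < 2) (hs : 0 ≤ s) : a < blend q s := by
  have h0 := cutoff_nonneg q
  have h1 := cutoff_le_one q
  unfold blend
  rcases h0.eq_or_lt with h | h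
  · rw [← h]; linarith
  · nlinarith

theorem hasDerivAt_blend {q : ℝ → ℝ} {q' s : ℝ} (hq : HasDerivAt q q' s) :
    HasDerivAt (fun s => blend (q s) s)
      ((deriv cutoff (q s) * (q s - 2 - s) + cutoff (q s)) * q' + (1 - cutoff (q s))) s := by
  have h1 := (hasDerivAt_cutoff (q s)).comp s hq
  have h2 := (h1.mul hq).add ((h1.const_sub 1).mul ((hasDerivAt_id s).const_add 2))
  refine h2.congr_deriv ?_
  simp only [Function.comp, id]
  ring

/-- Smoothness of the solution `s` of `H (x, s) = v` for `H` strictly monotone in `s`. -/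
theorem contDiffAt_of_implicit {H σ : ℝ × ℝ → ℝ} {J : Set ℝ} (hJ : IsOpen J) {x v : ℝ}
    (hinj : ∀ x s s', s ∈ J → s' ∈ J → H (x, s) = H (x, s') → s = s')
    (hσ : ∀ᶠ p in 𝓝 (x, v), σ p ∈ J ∧ H (p.1, σ p) = p.2)
    (hH : ContDiffAt ℝ ∞ H (x, σ (x, v)))
    (hpos : fderiv ℝ H (x, σ (x, v)) (0, 1) ≠ 0) : ContDiffAt ℝ ∞ σ (x, v) := by
  set s := σ (x, v) with hs
  obtain ⟨hsJ, hsv⟩ := hσ.self_of_nhds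
  change s ∈ J at hsJ
  change H (x, s) = v at hsv
  set Θ : ℝ × ℝ → ℝ × ℝ := fun p => (p.1, H p) with hΘ
  have hΘs : ContDiffAt ℝ ∞ Θ (x, s) := contDiffAt_fst.prodMk hH
  set B := fderiv ℝ H (x, s) with hB
  have hB' : HasFDerivAt H B (x, s) := (hH.differentiableAt (by simp)).hasFDerivAt
  set A : ℝ × ℝ →L[ℝ] ℝ × ℝ := (ContinuousLinearMap.fst ℝ ℝ ℝ).prod B with hA
  have hAd : HasFDerivAt Θ A (x, s) := hasFDerivAt_fst.prodMk hB'
  have hAinj : Function.Injective A := by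
    rw [injective_iff_map_eq_zero]
    rintro ⟨a, b⟩ hab
    have h1 : a = 0 := congrArg Prod.fst hab
    have h2 : B (a, b) = 0 := congrArg Prod.snd hab
    subst h1
    have h3 : B (0, b) = b * B (0, 1) := by
      have : ((0 : ℝ), b) = b • ((0 : ℝ), (1 : ℝ)) := by simp
      rw [this, map_smul, smul_eq_mul]
    rw [h3] at h2
    simp [(mul_eq_zero.1 h2).resolve_right hpos]
  let e : (ℝ × ℝ) ≃L[ℝ] (ℝ × ℝ) :=
    (LinearEquiv.ofInjectiveEndo A.toLinearMap hAinj).toContinuousLinearEquiv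
  have he : (e : ℝ × ℝ →L[ℝ] ℝ × ℝ) = A := by
    ext <;> rfl
  have hAd' : HasFDerivAt Θ (e : ℝ × ℝ →L[ℝ] ℝ × ℝ) (x, s) := by rw [he]; exact hAd
  have hn : (∞ : WithTop ℕ∞) ≠ 0 := by simp
  have hstr := hΘs.hasStrictFDerivAt' hAd' hn
  have hsm := hΘs.to_localInverse hAd' hn
  have hval : Θ (x, s) = (x, v) := by simp [hΘ, hsv]
  have hr := hstr.eventually_right_inverse
  have hc := hstr.localInverse_continuousAt
  rw [ContinuousAt, hstr.localInverse_apply_image] at hc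
  have hmem : ∀ᶠ p in 𝓝 (Θ (x, s)), (hstr.localInverse Θ e (x, s) p).2 ∈ J :=
    (continuous_snd.continuousAt.tendsto.comp hc).eventually (hJ.mem_nhds hsJ)
  rw [hval] at hsm hr hmem
  -- No continuity of `σ` is assumed: near `(x, v)` the local inverse of `(x, s) ↦ (x, H (x, s))`
  -- also takes values in `J`, and injectivity on `J` forces it to agree with `σ`.
  have : σ =ᶠ[𝓝 (x, v)] fun p => (hΘs.localInverse hAd' hn p).2 := by
    filter_upwards [hr, hmem, hσ] with p h1 h2 h3
    change σ p = (hstr.localInverse Θ e (x, s) p).2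
    set m := hstr.localInverse Θ e (x, s) p
    have h4 : (Θ m).1 = p.1 := congrArg Prod.fst h1
    have h5 : (Θ m).2 = p.2 := congrArg Prod.snd h1
    change m.1 = p.1 at h4
    change H m = p.2 at h5
    refine hinj p.1 _ _ h3.1 h2 ?_
    rw [h3.2, ← h4, ← h5]
  exact (contDiffAt_snd.comp _ hsm).congr_of_eventuallyEq this

/-! ### Labels on the annulus of chords -/

/-- Properties of the (rescaled) squared half chord length `q (x, s)` of the chord with end points
`c (x + s)` and `c (x - s)`, which is small only for `s` close to `0` or `1 / 2`. -/
structure IsCollar (q : ℝ × ℝ → ℝ) (δ : ℝ) : Prop where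
  contDiff : ContDiff ℝ ∞ q
  zero : ∀ x, q (x, 0) = 0
  pos : 0 < δ
  le : δ ≤ 1 / 8
  fderiv_pos : ∀ x s, 0 < s → s < δ → 0 < fderiv ℝ q (x, s) (0, 1)
  two_le : ∀ x s, δ ≤ s → s ≤ 1 / 2 - δ → 2 ≤ q (x, s)
  symm : ∀ x s, q (x + 1 / 2, 1 / 2 - s) = q (x, s)
  periodic : ∀ x s, q (x + 1, s) = q (x, s)

/-- The derivative in the second variable as a value of the Fréchet derivative. -/
theorem hasDerivAt_snd_of_differentiableAt {E : Type*} [NormedAddCommGroup E] [NormedSpace ℝ E]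
    {f : ℝ × ℝ → E} {x s : ℝ} (hf : DifferentiableAt ℝ f (x, s)) :
    HasDerivAt (fun s => f (x, s)) (fderiv ℝ f (x, s) (0, 1)) s :=
  hf.hasFDerivAt.comp_hasDerivAt (f := fun s => (x, s)) s
    ((hasDerivAt_const s x).prodMk (hasDerivAt_id s))

/-- The derivative in the first variable as a value of the Fréchet derivative. -/
theorem hasDerivAt_fst_of_differentiableAt {E : Type*} [NormedAddCommGroup E] [NormedSpace ℝ E]
    {f : ℝ × ℝ → E} {x s : ℝ} (hf : DifferentiableAt ℝ f (x, s)) :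
    HasDerivAt (fun x => f (x, s)) (fderiv ℝ f (x, s) (1, 0)) x :=
  hf.hasFDerivAt.comp_hasDerivAt (f := fun x => (x, s)) x
    ((hasDerivAt_id x).prodMk (hasDerivAt_const x s))

namespace IsCollar

variable {q : ℝ × ℝ → ℝ} {δ : ℝ}

theorem contDiff_blend (h : IsCollar q δ) : ContDiff ℝ ∞ (fun p : ℝ × ℝ => blend (q p) p.2) := by
  have h1 := contDiff_cutoff.comp h.contDiff
  have h2 := h.contDiff
  unfold blend
  exact (h1.mul h2).add ((contDiff_const.sub h1).mul (contDiff_const.add contDiff_snd))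

/-- Where `q ≥ 2` the blend is `2 + s`, of slope `1`. Where `q < 2`, `two_le` forces `s < δ`, so `q`
increases; the cutoff decreases while `q - 2 - s` is negative, so that term has the right sign too.
-/
theorem fderiv_blend_pos (h : IsCollar q δ) {x s : ℝ} (h0 : 0 < s) (h1 : s ≤ 3 / 8) :
    0 < fderiv ℝ (fun p : ℝ × ℝ => blend (q p) p.2) (x, s) (0, 1) := by
  have hd := hasDerivAt_snd_of_differentiableAt
    (h.contDiff_blend.differentiable (by simp) (x, s))
  have hq := hasDerivAt_snd_of_differentiableAt (h.contDiff.differentiable (by simp) (x, s))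
  rw [hd.unique (hasDerivAt_blend hq)]
  rcases le_or_gt 2 (q (x, s)) with h2 | h2
  · rw [cutoff_of_ge h2, deriv_cutoff_of_ge h2]; norm_num
  · have hsδ : s < δ := by
      by_contra! hc
      have := h.two_le x s hc (by linarith [h.le])
      linarith
    have hp := h.fderiv_pos x s h0 hsδ
    have hc0 := cutoff_nonneg (q (x, s))
    have hc1 := cutoff_le_one (q (x, s))
    have hc' := deriv_cutoff_nonpos (q (x, s))
    have e1 : 0 ≤ deriv cutoff (q (x, s)) * (q (x, s) - 2 - s) :=
      mul_nonneg_of_nonpos_of_nonpos hc' (by linarith)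
    rcases hc0.eq_or_lt with h3 | h3
    · rw [← h3]
      have := mul_nonneg e1 hp.le
      linarith
    · have := mul_pos (add_pos_of_nonneg_of_pos e1 h3) hp
      linarith

theorem blend_strictMonoOn (h : IsCollar q δ) (x : ℝ) :
    StrictMonoOn (fun s => blend (q (x, s)) s) (Icc 0 (3 / 8)) := by
  have hcont : Continuous (fun s => blend (q (x, s)) s) :=
    h.contDiff_blend.continuous.comp (Continuous.prodMk_right x)
  refine strictMonoOn_of_deriv_pos (convex_Icc _ _) hcont.continuousOn fun s hs => ?_
  rw [interior_Icc] at hs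
  rw [(hasDerivAt_snd_of_differentiableAt
    (h.contDiff_blend.differentiable (by simp) (x, s))).deriv]
  exact h.fderiv_blend_pos hs.1 hs.2.le

theorem exists_blend_eq (h : IsCollar q δ) (x : ℝ) {v : ℝ} (hv : v ∈ Ioo (0 : ℝ) (19 / 8)) :
    ∃ s ∈ Ioo (0 : ℝ) (3 / 8), blend (q (x, s)) s = v := by
  have hcont : Continuous (fun s => blend (q (x, s)) s) :=
    h.contDiff_blend.continuous.comp (Continuous.prodMk_right x)
  have := intermediate_value_Ioo (a := (0 : ℝ)) (b := 3 / 8) (by norm_num) hcont.continuousOn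
  have h0 : blend (q (x, 0)) 0 = 0 := by
    rw [h.zero, blend_of_le (by norm_num)]
  have h1 : blend (q (x, 3 / 8)) (3 / 8) = 19 / 8 := by
    rw [blend_of_ge (h.two_le x _ (by linarith [h.le]) (by linarith [h.le]))]; norm_num
  simp only [h0, h1] at this
  exact this hv

/-- The solution `s ∈ (0, 3/8)` of `blend (q (x, s)) s = v`, for `v ∈ (0, 19/8)`. -/
def halfSlice (q : ℝ × ℝ → ℝ) (p : ℝ × ℝ) : ℝ :=
  Classical.epsilon fun s => s ∈ Ioo (0 : ℝ) (3 / 8) ∧ blend (q (p.1, s)) s = p.2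

theorem halfSlice_spec (h : IsCollar q δ) (x : ℝ) {v : ℝ} (hv : v ∈ Ioo (0 : ℝ) (19 / 8)) :
    halfSlice q (x, v) ∈ Ioo (0 : ℝ) (3 / 8) ∧
      blend (q (x, halfSlice q (x, v))) (halfSlice q (x, v)) = v :=
  Classical.epsilon_spec (h.exists_blend_eq x hv)

theorem halfSlice_eq (h : IsCollar q δ) {x s v : ℝ} (hs : s ∈ Ioo (0 : ℝ) (3 / 8))
    (hv : v ∈ Ioo (0 : ℝ) (19 / 8)) (he : blend (q (x, s)) s = v) : halfSlice q (x, v) = s := by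
  have h1 := h.halfSlice_spec x hv
  exact (h.blend_strictMonoOn x).injOn (Ioo_subset_Icc_self h1.1) (Ioo_subset_Icc_self hs)
    (h1.2.trans he.symm)

/-- In this window around `9/4` the label is `2 + s`, whatever `x` is. The branch and its mirror
image therefore agree there, which makes `slice` smooth across the seam. -/
theorem halfSlice_of_mem (h : IsCollar q δ) {x v : ℝ} (hv : v ∈ Ioo (17 / 8 : ℝ) (19 / 8)) :
    halfSlice q (x, v) = v - 2 := by
  have := h.le
  have := h.pos
  refine h.halfSlice_eq ⟨by linarith [hv.1], by linarith [hv.2]⟩ ⟨by linarith [hv.1], hv.2⟩ ?_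
  rw [blend_of_ge (h.two_le _ _ (by linarith [hv.1]) (by linarith [hv.2]))]
  ring

theorem contDiffAt_halfSlice (h : IsCollar q δ) (x : ℝ) {v : ℝ} (hv : v ∈ Ioo (0 : ℝ) (19 / 8)) :
    ContDiffAt ℝ ∞ (halfSlice q) (x, v) := by
  refine contDiffAt_of_implicit (H := fun p => blend (q p) p.2) (isOpen_Ioo (a := 0) (b := 3 / 8))
    ?_ ?_ h.contDiff_blend.contDiffAt ?_
  · intro x s s' hs hs' he
    exact (h.blend_strictMonoOn x).injOn (Ioo_subset_Icc_self hs) (Ioo_subset_Icc_self hs') he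
  · have : ∀ᶠ p : ℝ × ℝ in 𝓝 (x, v), p.2 ∈ Ioo (0 : ℝ) (19 / 8) :=
      continuous_snd.continuousAt.eventually (isOpen_Ioo.mem_nhds hv)
    filter_upwards [this] with p hp using h.halfSlice_spec p.1 hp
  · have := (h.halfSlice_spec x hv).1
    exact (h.fderiv_blend_pos this.1 this.2.le).ne'

/-- Differentiating `blend (q (x, s)) s = v` along the solution gives a product equal to `1`. -/
theorem fderiv_halfSlice_ne_zero (h : IsCollar q δ) (x : ℝ) {v : ℝ}
    (hv : v ∈ Ioo (0 : ℝ) (19 / 8)) : fderiv ℝ (halfSlice q) (x, v) (0, 1) ≠ 0 := by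
  intro h0
  have h1 := hasDerivAt_snd_of_differentiableAt
    ((h.contDiffAt_halfSlice x hv).differentiableAt (by simp))
  rw [h0] at h1
  have h2 := hasDerivAt_snd_of_differentiableAt
    (h.contDiff_blend.differentiable (by simp) (x, halfSlice q (x, v)))
  have h3 := h2.comp v h1
  have h4 : (fun s => blend (q (x, s)) s) ∘ (fun s => halfSlice q (x, s)) =ᶠ[𝓝 v] id := by
    filter_upwards [isOpen_Ioo.mem_nhds hv] with w hw using (h.halfSlice_spec x hw).2
  have h5 := h3.congr_of_eventuallyEq h4.symm
  have := h5.unique (hasDerivAt_id v)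
  simp at this

/-- The parameter `s ∈ (0, 1/2)` with label `v ∈ (0, 9/2)`: for `v ≤ 5/4` it is the small solution
of `q (x, s) = v`, for `v ≥ 13/4` the large solution of `q (x, s) = 9/2 - v`. -/
def slice (q : ℝ × ℝ → ℝ) (p : ℝ × ℝ) : ℝ :=
  if p.2 < 9 / 4 then halfSlice q p else 1 / 2 - halfSlice q (p.1 + 1 / 2, 9 / 2 - p.2)

theorem slice_of_lt (h : IsCollar q δ) (x : ℝ) {v : ℝ} (hv : v < 19 / 8) :
    slice q (x, v) = halfSlice q (x, v) := by
  rw [slice]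
  split_ifs with h1
  · rfl
  · simp only [not_lt] at h1
    rw [h.halfSlice_of_mem ⟨by linarith, hv⟩, h.halfSlice_of_mem ⟨by linarith, by linarith⟩]
    ring

theorem slice_of_gt (h : IsCollar q δ) (x : ℝ) {v : ℝ} (hv : 17 / 8 < v) :
    slice q (x, v) = 1 / 2 - halfSlice q (x + 1 / 2, 9 / 2 - v) := by
  rw [slice]
  split_ifs with h1
  · simp only at h1
    rw [h.halfSlice_of_mem ⟨hv, by linarith⟩, h.halfSlice_of_mem ⟨by linarith, by linarith⟩]
    ring
  · rfl

theorem slice_periodic (h : IsCollar q δ) (x v : ℝ) : slice q (x + 1, v) = slice q (x, v) := by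
  have h1 : ∀ x v, halfSlice q (x + 1, v) = halfSlice q (x, v) := by
    intro x v
    simp only [halfSlice, h.periodic]
  rw [slice, slice, add_right_comm, h1]
  simp only [h1]

/-- Exchanging the end points of the chord reflects the labels about `9/4`; this is the source of
the invariance under `R_π`. -/
theorem slice_symm (h : IsCollar q δ) (x v : ℝ) :
    slice q (x + 1 / 2, 9 / 2 - v) = 1 / 2 - slice q (x, v) := by
  have hp : ∀ v, slice q (x + 1 / 2 + 1 / 2, v) = slice q (x, v) := by
    intro v
    rw [add_assoc, show (1 / 2 + 1 / 2 : ℝ) = 1 by norm_num, h.slice_periodic]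
  rcases lt_or_ge v (19 / 8) with hv | hv
  · rw [h.slice_of_gt _ (by linarith), h.slice_of_lt x hv, ← h.slice_of_lt _ (by linarith), hp,
      h.slice_of_lt x (by linarith)]
    norm_num
  · rw [h.slice_of_lt _ (by linarith), h.slice_of_gt x (by linarith)]
    ring

theorem contDiffAt_slice (h : IsCollar q δ) (x : ℝ) {v : ℝ} (hv : v ∈ Ioo (0 : ℝ) (9 / 2)) :
    ContDiffAt ℝ ∞ (slice q) (x, v) := by
  rcases lt_or_ge v (19 / 8) with h1 | h1
  · refine (h.contDiffAt_halfSlice x ⟨hv.1, h1⟩).congr_of_eventuallyEq ?_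
    filter_upwards [continuous_snd.continuousAt.eventually (Iio_mem_nhds h1)] with p hp
    exact h.slice_of_lt p.1 hp
  · have h2 := h.contDiffAt_halfSlice (x + 1 / 2) (v := 9 / 2 - v)
      ⟨by linarith [hv.2], by linarith⟩
    have h3 : ContDiffAt ℝ ∞ (fun p : ℝ × ℝ => (p.1 + 1 / 2, 9 / 2 - p.2)) (x, v) := by fun_prop
    have h4 : ContDiffAt ℝ ∞ (fun p : ℝ × ℝ => 1 / 2 - halfSlice q (p.1 + 1 / 2, 9 / 2 - p.2))
      (x, v) := contDiffAt_const.sub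
        (ContDiffAt.comp (g := halfSlice q) (x, v) h2 h3)
    refine h4.congr_of_eventuallyEq ?_
    filter_upwards [continuous_snd.continuousAt.eventually
      (Ioi_mem_nhds (show 17 / 8 < v by linarith))] with p hp
    exact h.slice_of_gt p.1 hp

theorem fderiv_slice_ne_zero (h : IsCollar q δ) (x : ℝ) {v : ℝ}
    (hv : v ∈ Ioo (0 : ℝ) (9 / 2)) : fderiv ℝ (slice q) (x, v) (0, 1) ≠ 0 := by
  have hd := hasDerivAt_snd_of_differentiableAt
    ((h.contDiffAt_slice x hv).differentiableAt (by simp))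
  rcases lt_or_ge v (19 / 8) with h1 | h1
  · have hv' : v ∈ Ioo (0 : ℝ) (19 / 8) := ⟨hv.1, h1⟩
    have h2 := hasDerivAt_snd_of_differentiableAt
      ((h.contDiffAt_halfSlice x hv').differentiableAt (by simp))
    have h3 : (fun v => slice q (x, v)) =ᶠ[𝓝 v] fun v => halfSlice q (x, v) := by
      filter_upwards [Iio_mem_nhds h1] with w hw using h.slice_of_lt x hw
    rw [(hd.congr_of_eventuallyEq h3.symm).unique h2]
    exact h.fderiv_halfSlice_ne_zero x hv'
  · have hv' : 9 / 2 - v ∈ Ioo (0 : ℝ) (19 / 8) := ⟨by linarith [hv.2], by linarith⟩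
    have h2 := hasDerivAt_snd_of_differentiableAt
      ((h.contDiffAt_halfSlice (x + 1 / 2) hv').differentiableAt (by simp))
    have h4 := (h2.comp v ((hasDerivAt_id v).const_sub (9 / 2))).const_sub (1 / 2)
    have h3 : (fun v => slice q (x, v)) =ᶠ[𝓝 v]
        fun v => 1 / 2 - halfSlice q (x + 1 / 2, 9 / 2 - v) := by
      filter_upwards [Ioi_mem_nhds (show 17 / 8 < v by linarith)] with w hw
        using h.slice_of_gt x hw
    rw [(hd.congr_of_eventuallyEq h3.symm).unique h4]
    simpa using h.fderiv_halfSlice_ne_zero (x + 1 / 2) hv'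

theorem slice_mem (h : IsCollar q δ) (x : ℝ) {v : ℝ} (hv : v ∈ Ioo (0 : ℝ) (9 / 2)) :
    slice q (x, v) ∈ Ioo (0 : ℝ) (1 / 2) := by
  rcases lt_or_ge v (19 / 8) with h1 | h1
  · rw [h.slice_of_lt x h1]
    have := (h.halfSlice_spec x ⟨hv.1, h1⟩).1
    exact ⟨this.1, by linarith [this.2]⟩
  · rw [h.slice_of_gt x (by linarith)]
    have := (h.halfSlice_spec (x + 1 / 2) (v := 9 / 2 - v) ⟨by linarith [hv.2], by linarith⟩).1
    exact ⟨by linarith [this.2], by linarith [this.1]⟩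

theorem slice_le_iff (h : IsCollar q δ) (x : ℝ) {v : ℝ} (hv : v ∈ Ioo (0 : ℝ) (19 / 8)) :
    slice q (x, v) ≤ 1 / 4 ↔ v ≤ 9 / 4 := by
  rw [h.slice_of_lt x hv.2]
  have h1 := h.halfSlice_spec x hv
  have h2 : blend (q (x, 1 / 4)) (1 / 4) = 9 / 4 := by
    rw [blend_of_ge (h.two_le x _ (by linarith [h.le]) (by linarith [h.le]))]; norm_num
  have h3 := (h.blend_strictMonoOn x).le_iff_le (Ioo_subset_Icc_self h1.1)
    (show (1 / 4 : ℝ) ∈ Icc (0 : ℝ) (3 / 8) by norm_num)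
  simp only [h1.2, h2] at h3
  exact h3.symm

/-- On the first collar, the slice is a level set of `q`. -/
theorem slice_of_le (h : IsCollar q δ) (x : ℝ) {v : ℝ} (h0 : 0 < v) (hv : v ≤ 5 / 4) :
    q (x, slice q (x, v)) = v ∧ slice q (x, v) < δ := by
  rw [h.slice_of_lt x (by linarith)]
  have h1 := h.halfSlice_spec x (v := v) ⟨h0, by linarith⟩
  set s := halfSlice q (x, v)
  have h2 : q (x, s) ≤ 5 / 4 := by
    by_contra! hc
    have := lt_blend hc (by norm_num) h1.1.1.le
    linarith [h1.2]
  have h3 : q (x, s) = v := by rw [← h1.2, blend_of_le h2]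
  refine ⟨h3, ?_⟩
  by_contra! hc
  have := h.two_le x s hc (by linarith [h1.1.2, h.le])
  linarith

theorem slice_of_ge (h : IsCollar q δ) (x : ℝ) {v : ℝ} (h0 : 13 / 4 ≤ v) (hv : v < 9 / 2) :
    q (x, slice q (x, v)) = 9 / 2 - v := by
  have h1 := (h.slice_of_le (x + 1 / 2) (v := 9 / 2 - v) (by linarith) (by linarith)).1
  rw [h.slice_symm, h.symm] at h1
  exact h1

/-- If `q < 1`, the blend would be `q` itself and the label would be below `1`; labels above `9/4`
are reflected. Thus these slices stay at `|w| ≥ ε`. -/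
theorem one_le_of_slice (h : IsCollar q δ) (x : ℝ) {v : ℝ} (hv : v ∈ Icc (1 : ℝ) (7 / 2)) :
    1 ≤ q (x, slice q (x, v)) := by
  have key : ∀ x v : ℝ, v ∈ Icc (1 : ℝ) (9 / 4) → 1 ≤ q (x, slice q (x, v)) := by
    intro x v hv
    rw [h.slice_of_lt x (by linarith [hv.2])]
    have h1 := h.halfSlice_spec x (v := v) ⟨by linarith [hv.1], by linarith [hv.2]⟩
    by_contra! hc
    have := h1.2
    rw [blend_of_le (by linarith)] at this
    linarith [hv.1]
  rcases le_total v (9 / 4) with h1 | h1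
  · exact key x v ⟨hv.1, h1⟩
  · have := key (x + 1 / 2) (9 / 2 - v) ⟨by linarith [hv.2], by linarith⟩
    rwa [h.slice_symm, h.symm] at this

/-- Each branch is injective because the blend recovers the label. The two branches are kept apart
by `s = 1/4`, the value at the seam `v = 9/4`. -/
theorem slice_injective (h : IsCollar q δ) (x : ℝ) {v v' : ℝ} (hv : v ∈ Ioo (0 : ℝ) (9 / 2))
    (hv' : v' ∈ Ioo (0 : ℝ) (9 / 2)) (he : slice q (x, v) = slice q (x, v')) : v = v' := by
  have low : ∀ x v v' : ℝ, v ∈ Ioo (0 : ℝ) (19 / 8) → v' ∈ Ioo (0 : ℝ) (19 / 8) →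
      slice q (x, v) = slice q (x, v') → v = v' := by
    intro x v v' hv hv' he
    rw [h.slice_of_lt x hv.2, h.slice_of_lt x hv'.2] at he
    have h1 := h.halfSlice_spec x hv
    have h2 := h.halfSlice_spec x hv'
    rw [he] at h1
    exact h1.2.symm.trans h2.2
  have small : ∀ v ∈ Ioo (0 : ℝ) (9 / 2), v ≤ 9 / 4 → slice q (x, v) ≤ 1 / 4 := fun v hv h1 =>
    (h.slice_le_iff x ⟨hv.1, by linarith⟩).2 h1
  have large : ∀ v ∈ Ioo (0 : ℝ) (9 / 2), 9 / 4 < v → 1 / 4 < slice q (x, v) := by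
    intro v hv h1
    rcases lt_or_ge v (19 / 8) with h2 | h2
    · by_contra! hc
      linarith [(h.slice_le_iff x ⟨hv.1, h2⟩).1 hc]
    · rw [h.slice_of_gt x (by linarith), ← h.slice_of_lt _ (by linarith)]
      have h3 : 9 / 2 - v ∈ Ioo (0 : ℝ) (19 / 8) := ⟨by linarith [hv.2], by linarith⟩
      rcases (((h.slice_le_iff (x + 1 / 2) h3).2 (by linarith))).lt_or_eq with h4 | h4
      · linarith
      · have h5 : slice q (x + 1 / 2, 9 / 4) = 1 / 4 := by
          rw [h.slice_of_lt _ (by norm_num), h.halfSlice_of_mem (by norm_num)]; norm_num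
        have := low _ _ _ h3 (by norm_num) (h4.trans h5.symm)
        linarith
  rcases le_or_gt v (9 / 4) with h1 | h1 <;> rcases le_or_gt v' (9 / 4) with h2 | h2
  · exact low x v v' ⟨hv.1, by linarith⟩ ⟨hv'.1, by linarith⟩ he
  · linarith [small v hv h1, large v' hv' h2]
  · linarith [small v' hv' h2, large v hv h1]
  · have := low (x + 1 / 2) (9 / 2 - v) (9 / 2 - v') ⟨by linarith [hv.2], by linarith⟩
      ⟨by linarith [hv'.2], by linarith⟩ (by rw [h.slice_symm, h.slice_symm, he])
    linarith

/-- Every point outside the collars lies on a slice with label in `[1, 7/2]`. -/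
theorem exists_slice_eq (h : IsCollar q δ) {x s : ℝ} (hs : s ∈ Ioo (0 : ℝ) (1 / 2))
    (hq : 1 ≤ q (x, s)) : ∃ v ∈ Icc (1 : ℝ) (7 / 2), slice q (x, v) = s := by
  have key : ∀ x s : ℝ, s ∈ Ioc (0 : ℝ) (1 / 4) → 1 ≤ q (x, s) →
      ∃ v ∈ Icc (1 : ℝ) (9 / 4), slice q (x, v) = s := by
    intro x s hs hq
    have h1 : 1 ≤ blend (q (x, s)) s := by
      rcases hq.eq_or_lt with h1 | h1
      · rw [← h1, blend_of_le (by norm_num)]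
      · exact (lt_blend h1 (by norm_num) hs.1.le).le
    have h2 : blend (q (x, s)) s ≤ 9 / 4 := by
      have h2 : blend (q (x, 1 / 4)) (1 / 4) = 9 / 4 := by
        rw [blend_of_ge (h.two_le x _ (by linarith [h.le]) (by linarith [h.le]))]; norm_num
      rw [← h2]
      exact (h.blend_strictMonoOn x).monotoneOn ⟨hs.1.le, by linarith [hs.2]⟩ (by norm_num) hs.2
    refine ⟨_, ⟨h1, h2⟩, ?_⟩
    rw [h.slice_of_lt x (by linarith)]
    exact h.halfSlice_eq ⟨hs.1, by linarith [hs.2]⟩ ⟨by linarith, by linarith⟩ rfl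
  rcases le_total s (1 / 4) with h1 | h1
  · obtain ⟨v, hv, he⟩ := key x s ⟨hs.1, h1⟩ hq
    exact ⟨v, ⟨hv.1, by linarith [hv.2]⟩, he⟩
  · obtain ⟨v, hv, he⟩ := key (x + 1 / 2) (1 / 2 - s) ⟨by linarith [hs.2], by linarith⟩
      (by rwa [h.symm])
    refine ⟨9 / 2 - v, ⟨by linarith [hv.2], by linarith [hv.1]⟩, ?_⟩
    have := h.slice_symm x (9 / 2 - v)
    rw [sub_sub_cancel, he] at this
    linarith

end IsCollar

/-! ### Chords of a regular closed curve -/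

/-- A smooth regular simple closed curve, as a `1`-periodic function. -/
structure IsRegularLoop (c : ℝ → ℂ) : Prop where
  contDiff : ContDiff ℝ ∞ c
  periodic : Function.Periodic c 1
  deriv_ne : ∀ t, deriv c t ≠ 0
  inj : ∀ t u, c t = c u → ∃ n : ℤ, u = t + n

/-- The midpoint of the chord with end points `c (x + s)` and `c (x - s)`. -/
def mid (c : ℝ → ℂ) (x s : ℝ) : ℂ := (c (x + s) + c (x - s)) / 2

/-- Half of the chord with end points `c (x + s)` and `c (x - s)`. -/
def chord (c : ℝ → ℂ) (x s : ℝ) : ℂ := (c (x + s) - c (x - s)) / 2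

/-- The squared length of the half chord. -/
def chordSq (c : ℝ → ℂ) (p : ℝ × ℝ) : ℝ := Complex.normSq (chord c p.1 p.2)

/-- The real inner product of the plane. -/
def dot (a b : ℂ) : ℝ := a.re * b.re + a.im * b.im

theorem continuous_dot : Continuous fun p : ℂ × ℂ => dot p.1 p.2 := by
  unfold dot
  fun_prop

theorem dot_self_pos {a : ℂ} (h : a ≠ 0) : 0 < dot a a := by
  have := Complex.normSq_pos.2 h
  rwa [Complex.normSq_apply] at this

theorem hasDerivAt_normSq {f : ℝ → ℂ} {f' : ℂ} {t : ℝ} (hf : HasDerivAt f f' t) :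
    HasDerivAt (fun t => Complex.normSq (f t)) (2 * dot (f t) f') t := by
  have h1 : HasDerivAt (fun t => (f t).re) f'.re t :=
    Complex.reCLM.hasFDerivAt.comp_hasDerivAt t hf
  have h2 : HasDerivAt (fun t => (f t).im) f'.im t :=
    Complex.imCLM.hasFDerivAt.comp_hasDerivAt t hf
  simp only [Complex.normSq_apply]
  refine ((h1.mul h1).add (h2.mul h2)).congr_deriv ?_
  unfold dot
  ring

/-- The half chord, divided by `s`. -/
def chordSlope (c : ℝ → ℂ) (x s : ℝ) : ℂ := (∫ u in (-1 : ℝ)..1, deriv c (x + u * s)) / 2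

/-- The partial derivative of `mid` in `x` and of `chord` in `s`. -/
def dsum (c : ℝ → ℂ) (x s : ℝ) : ℂ := (deriv c (x + s) + deriv c (x - s)) / 2

/-- The partial derivative of `mid` in `s` and of `chord` in `x`. -/
def ddiff (c : ℝ → ℂ) (x s : ℝ) : ℂ := (deriv c (x + s) - deriv c (x - s)) / 2

namespace IsRegularLoop

variable {c : ℝ → ℂ}

theorem add_int (hc : IsRegularLoop c) (t : ℝ) (n : ℤ) : c (t + n) = c t := by
  have := hc.periodic.int_mul n t
  rwa [mul_one] at this

theorem hasDerivAt (hc : IsRegularLoop c) (t : ℝ) : HasDerivAt c (deriv c t) t :=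
  (hc.contDiff.differentiable (by simp) t).hasDerivAt

theorem continuous_deriv (hc : IsRegularLoop c) : Continuous (deriv c) :=
  hc.contDiff.continuous_deriv (by simp)

theorem deriv_add_int (hc : IsRegularLoop c) (t : ℝ) (n : ℤ) : deriv c (t + n) = deriv c t := by
  rw [← deriv_comp_add_const]
  congr 1
  ext t
  exact hc.add_int t n

/-- Points of the curve that are close in the plane have close parameters. -/
theorem exists_separation (hc : IsRegularLoop c) {δ : ℝ} (hδ : 0 < δ) :
    ∃ κ > 0, ∀ t t', ‖c t - c t'‖ < κ → ∃ n : ℤ, |t' - t - n| < δ := by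
  -- One period of `t`, with parameter gaps bounded away from the integers: by simplicity the
  -- distance has a positive minimum there.
  have hK : IsCompact (Icc (0 : ℝ) 1 ×ˢ Icc δ (1 - δ)) := isCompact_Icc.prod isCompact_Icc
  have hcont : Continuous fun p : ℝ × ℝ => ‖c p.1 - c (p.1 + p.2)‖ := by
    have := hc.contDiff.continuous
    fun_prop
  obtain ⟨κ, hκ, hmin⟩ := hK.exists_forall_le' hcont.continuousOn (a := 0) (by
    rintro ⟨t, u⟩ ⟨-, hu⟩
    rw [norm_pos_iff, sub_ne_zero]
    intro he
    obtain ⟨n, hn⟩ := hc.inj _ _ he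
    have h1 : u = n := by linarith
    have h2 : (0 : ℝ) < n := by rw [← h1]; linarith [hu.1]
    have h3 : (n : ℝ) < 1 := by rw [← h1]; linarith [hu.2]
    have h4 : 0 < n := by exact_mod_cast h2
    have h5 : n < 1 := by exact_mod_cast h3
    omega)
  refine ⟨κ, hκ, fun t t' ht => ?_⟩
  by_contra! hcon
  have h1 := hcon ⌊t' - t⌋
  have h2 := hcon (⌊t' - t⌋ + 1)
  have h3 := Int.floor_le (t' - t)
  have h4 := Int.lt_floor_add_one (t' - t)
  rw [abs_of_nonneg (by linarith)] at h1
  push_cast at h2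
  rw [abs_of_neg (by linarith)] at h2
  have h5 := hmin (Int.fract t, t' - t - ⌊t' - t⌋)
    ⟨⟨Int.fract_nonneg t, (Int.fract_lt_one t).le⟩, ⟨h1, by linarith⟩⟩
  have h6 : c (Int.fract t) = c t := by
    rw [← hc.add_int (Int.fract t) ⌊t⌋, Int.fract_add_floor]
  have h7 : c (Int.fract t + (t' - t - ⌊t' - t⌋)) = c t' := by
    rw [← hc.add_int _ (⌊t⌋ + ⌊t' - t⌋)]
    congr 1
    push_cast
    linarith [Int.fract_add_floor t]
  simp only [h6, h7] at h5
  linarith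

theorem chord_eq (hc : IsRegularLoop c) (x s : ℝ) : chord c x s = s * chordSlope c x s := by
  have hd : ∀ u ∈ uIcc (-1 : ℝ) 1,
      HasDerivAt (fun u => c (x + u * s)) ((s : ℂ) * deriv c (x + u * s)) u := by
    intro u _
    have h1 : HasDerivAt (fun u : ℝ => x + u * s) s u := by
      simpa using ((hasDerivAt_id u).mul_const s).const_add x
    exact ((hc.hasDerivAt (x + u * s)).scomp u h1).congr_deriv (by simp)
  have hi : Continuous fun u => (s : ℂ) * deriv c (x + u * s) :=
    continuous_const.mul (hc.continuous_deriv.comp (by fun_prop))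
  have := intervalIntegral.integral_eq_sub_of_hasDerivAt hd (hi.intervalIntegrable _ _)
  rw [intervalIntegral.integral_const_mul] at this
  rw [chord, chordSlope, ← mul_div_assoc, this]
  congr 3 <;> congr 1 <;> ring

theorem chordSlope_zero (c : ℝ → ℂ) (x : ℝ) : chordSlope c x 0 = deriv c x := by
  simp [chordSlope]
  norm_num

theorem continuous_chordSlope (hc : IsRegularLoop c) :
    Continuous fun p : ℝ × ℝ => chordSlope c p.1 p.2 := by
  unfold chordSlope
  refine Continuous.div_const ?_ 2
  refine intervalIntegral.continuous_parametric_intervalIntegral_of_continuous'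
    (f := fun (p : ℝ × ℝ) u => deriv c (p.1 + u * p.2)) ?_ (-1) 1
  exact hc.continuous_deriv.comp (by fun_prop)

theorem chordSlope_add_int (hc : IsRegularLoop c) (x s : ℝ) (n : ℤ) :
    chordSlope c (x + n) s = chordSlope c x s := by
  unfold chordSlope
  congr 2
  ext u
  rw [add_right_comm, hc.deriv_add_int]

theorem dsum_add_int (hc : IsRegularLoop c) (x s : ℝ) (n : ℤ) :
    dsum c (x + n) s = dsum c x s := by
  unfold dsum
  rw [add_right_comm, hc.deriv_add_int, ← hc.deriv_add_int (x - s) n, sub_add_eq_add_sub]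

theorem ddiff_add_int (hc : IsRegularLoop c) (x s : ℝ) (n : ℤ) :
    ddiff c (x + n) s = ddiff c x s := by
  unfold ddiff
  rw [add_right_comm, hc.deriv_add_int, ← hc.deriv_add_int (x - s) n, sub_add_eq_add_sub]

/-- Near the diagonal the chords are almost tangent to the curve. -/
theorem exists_tangency (hc : IsRegularLoop c) : ∃ δ > 0, ∀ x u s, |u| < δ → |s| < δ →
    0 < dot (chordSlope c x s) (dsum c x s) ∧
    0 < dot (deriv c x)
      (dot (chordSlope c (x + u) s) (dsum c (x + u) s) • dsum c (x + u) s -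
        dot (chordSlope c (x + u) s) (ddiff c (x + u) s) • ddiff c (x + u) s) := by
  have hd := hc.continuous_deriv
  have hk := hc.continuous_chordSlope
  have hA : Continuous fun p : ℝ × ℝ => dsum c p.1 p.2 := by unfold dsum; fun_prop
  have hB : Continuous fun p : ℝ × ℝ => ddiff c p.1 p.2 := by unfold ddiff; fun_prop
  have hg1 : Continuous fun p : ℝ × ℝ × ℝ => (p.1, p.2.2) := by fun_prop
  have hg2 : Continuous fun p : ℝ × ℝ × ℝ => (p.1 + p.2.1, p.2.2) := by fun_prop
  have hP : Continuous fun p : ℝ × ℝ × ℝ =>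
      dot (chordSlope c p.1 p.2.2) (dsum c p.1 p.2.2) :=
    continuous_dot.comp ((hk.comp hg1).prodMk (hA.comp hg1))
  have hkA := continuous_dot.comp ((hk.comp hg2).prodMk (hA.comp hg2))
  have hkB := continuous_dot.comp ((hk.comp hg2).prodMk (hB.comp hg2))
  have hT : Continuous fun p : ℝ × ℝ × ℝ => dot (deriv c p.1)
      (dot (chordSlope c (p.1 + p.2.1) p.2.2) (dsum c (p.1 + p.2.1) p.2.2) •
          dsum c (p.1 + p.2.1) p.2.2 -
        dot (chordSlope c (p.1 + p.2.1) p.2.2) (ddiff c (p.1 + p.2.1) p.2.2) •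
          ddiff c (p.1 + p.2.1) p.2.2) :=
    continuous_dot.comp ((hd.comp continuous_fst).prodMk
      ((hkA.smul (hA.comp hg2)).sub (hkB.smul (hB.comp hg2))))
  have hO := (isOpen_lt (continuous_const (y := (0 : ℝ))) hP).inter
    (isOpen_lt (continuous_const (y := (0 : ℝ))) hT)
  -- At `u = s = 0` the slope and `dsum` equal `c'` and `ddiff` vanishes, so the two quantities are
  -- `|c'|²` and `|c'|⁴`. Positivity then persists on a uniform neighborhood of one period.
  have hK : IsCompact (Icc (0 : ℝ) 1 ×ˢ ({0} ×ˢ {0} : Set (ℝ × ℝ))) :=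
    isCompact_Icc.prod (isCompact_singleton.prod isCompact_singleton)
  obtain ⟨δ, hδ, hsub⟩ := hK.exists_thickening_subset_open hO (by
    rintro ⟨x, u, s⟩ ⟨-, hu, hs⟩
    simp only [mem_singleton_iff] at hu hs
    subst hu hs
    have h1 : dsum c x 0 = deriv c x := by simp [dsum]
    have h2 : ddiff c x 0 = 0 := by simp [ddiff]
    have h3 := dot_self_pos (hc.deriv_ne x)
    refine ⟨?_, ?_⟩
    · simpa [chordSlope_zero, h1] using h3
    · simp only [mem_ofPred_eq, add_zero, chordSlope_zero, h1, h2, smul_zero, sub_zero]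
      have : dot (deriv c x) (dot (deriv c x) (deriv c x) • deriv c x) =
          dot (deriv c x) (deriv c x) * dot (deriv c x) (deriv c x) := by
        simp only [dot, Complex.smul_re, Complex.smul_im, smul_eq_mul]
        ring
      rw [this]
      positivity)
  refine ⟨δ, hδ, fun x u s hu hs => ?_⟩
  have hmem : (Int.fract x, u, s) ∈ Metric.thickening δ
      (Icc (0 : ℝ) 1 ×ˢ ({0} ×ˢ {0} : Set (ℝ × ℝ))) := by
    refine Metric.mem_thickening_iff.2 ⟨(Int.fract x, 0, 0),
      ⟨⟨Int.fract_nonneg x, (Int.fract_lt_one x).le⟩, rfl, rfl⟩, ?_⟩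
    simp [Prod.dist_eq, hu, hs]
  obtain ⟨h1, h2⟩ := hsub hmem
  have hx : x = Int.fract x + ⌊x⌋ := (Int.fract_add_floor x).symm
  have hxu : x + u = Int.fract x + u + ⌊x⌋ := by linarith
  rw [hxu, hc.chordSlope_add_int, hc.dsum_add_int, hc.ddiff_add_int]
  have e1 : chordSlope c x s = chordSlope c (Int.fract x) s := by
    conv_lhs => rw [hx, hc.chordSlope_add_int]
  have e2 : dsum c x s = dsum c (Int.fract x) s := by conv_lhs => rw [hx, hc.dsum_add_int]
  have e3 : deriv c x = deriv c (Int.fract x) := by conv_lhs => rw [hx, hc.deriv_add_int]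
  rw [e1, e2, e3]
  exact ⟨h1, h2⟩

theorem contDiff_chordSq (hc : IsRegularLoop c) : ContDiff ℝ ∞ (chordSq c) := by
  have h := hc.contDiff
  have h1 : ContDiff ℝ ∞ fun p : ℝ × ℝ => chord c p.1 p.2 := by
    unfold chord
    fun_prop
  have h2 : ContDiff ℝ ∞ fun p : ℝ × ℝ => (chord c p.1 p.2).re :=
    Complex.reCLM.contDiff.comp h1
  have h3 : ContDiff ℝ ∞ fun p : ℝ × ℝ => (chord c p.1 p.2).im :=
    Complex.imCLM.contDiff.comp h1
  unfold chordSq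
  simp only [Complex.normSq_apply]
  exact (h2.mul h2).add (h3.mul h3)

theorem hasDerivAt_chord (hc : IsRegularLoop c) {x s : ℝ → ℝ} {x' s' t : ℝ}
    (hx : HasDerivAt x x' t) (hs : HasDerivAt s s' t) :
    HasDerivAt (fun t => chord c (x t) (s t))
      (x' • ddiff c (x t) (s t) + s' • dsum c (x t) (s t)) t := by
  have h1 := (hc.hasDerivAt (x t + s t)).scomp t (hx.add hs)
  have h2 := (hc.hasDerivAt (x t - s t)).scomp t (hx.sub hs)
  refine ((h1.sub h2).div_const 2).congr_deriv ?_
  simp only [ddiff, dsum, Complex.real_smul]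
  push_cast
  ring

theorem hasDerivAt_mid (hc : IsRegularLoop c) {x s : ℝ → ℝ} {x' s' t : ℝ}
    (hx : HasDerivAt x x' t) (hs : HasDerivAt s s' t) :
    HasDerivAt (fun t => mid c (x t) (s t))
      (x' • dsum c (x t) (s t) + s' • ddiff c (x t) (s t)) t := by
  have h1 := (hc.hasDerivAt (x t + s t)).scomp t (hx.add hs)
  have h2 := (hc.hasDerivAt (x t - s t)).scomp t (hx.sub hs)
  refine ((h1.add h2).div_const 2).congr_deriv ?_
  simp only [ddiff, dsum, Complex.real_smul]
  push_cast
  ring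

theorem fderiv_chordSq (hc : IsRegularLoop c) (x s : ℝ) :
    fderiv ℝ (chordSq c) (x, s) (0, 1) = 2 * dot (chord c x s) (dsum c x s) := by
  have h1 := hasDerivAt_snd_of_differentiableAt
    (hc.contDiff_chordSq.differentiable (by simp) (x, s))
  have h2 := hasDerivAt_normSq (hc.hasDerivAt_chord (hasDerivAt_const s x) (hasDerivAt_id s))
  simpa using h1.unique h2

theorem mid_add_half (hc : IsRegularLoop c) (x s : ℝ) :
    mid c (x + 1 / 2) (1 / 2 - s) = mid c x s := by
  unfold mid
  rw [show x + 1 / 2 + (1 / 2 - s) = x - s + 1 by ring, hc.periodic,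
    show x + 1 / 2 - (1 / 2 - s) = x + s by ring, add_comm]

theorem chord_add_half (hc : IsRegularLoop c) (x s : ℝ) :
    chord c (x + 1 / 2) (1 / 2 - s) = -chord c x s := by
  unfold chord
  rw [show x + 1 / 2 + (1 / 2 - s) = x - s + 1 by ring, hc.periodic,
    show x + 1 / 2 - (1 / 2 - s) = x + s by ring]
  ring

theorem mid_add_one (hc : IsRegularLoop c) (x s : ℝ) : mid c (x + 1) s = mid c x s := by
  unfold mid
  rw [show x + 1 + s = x + s + 1 by ring, hc.periodic, show x + 1 - s = x - s + 1 by ring,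
    hc.periodic]

theorem chord_add_one (hc : IsRegularLoop c) (x s : ℝ) : chord c (x + 1) s = chord c x s := by
  unfold chord
  rw [show x + 1 + s = x + s + 1 by ring, hc.periodic, show x + 1 - s = x - s + 1 by ring,
    hc.periodic]

end IsRegularLoop

theorem sq_norm_chord (c : ℝ → ℂ) (x s : ℝ) : ‖chord c x s‖ ^ 2 = chordSq c (x, s) :=
  Complex.sq_norm _

/-! ### Choice of the scale -/

/-- The squared half chord length, in units of `ε ^ 2`. -/
def scaledSq (c : ℝ → ℂ) (ε : ℝ) (p : ℝ × ℝ) : ℝ := chordSq c p / ε ^ 2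

/-- A scale `ε` at which the parts of `L` with `|w| < 2 ε` are thin collars of the diagonal. -/
structure IsGoodScale (c : ℝ → ℂ) (ε δ δ' : ℝ) : Prop where
  pos : 0 < ε
  collar : IsCollar (scaledSq c ε) δ
  lt : δ < δ'
  tangency : ∀ x u s, |u| < δ' → |s| < δ' →
    0 < dot (chordSlope c x s) (dsum c x s) ∧
    0 < dot (deriv c x)
      (dot (chordSlope c (x + u) s) (dsum c (x + u) s) • dsum c (x + u) s -
        dot (chordSlope c (x + u) s) (ddiff c (x + u) s) • ddiff c (x + u) s)
  separation : ∀ t t', ‖c t - c t'‖ < 4 * ε → ∃ n : ℤ, |t' - t - n| < δ' - δ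

/-- The parameter widths `δ < δ'` come first, from tangency alone; then `ε` is taken so small that
chords between parameters at least `2 δ` apart are longer than the collar, and nearby points have
nearby parameters. -/
theorem IsRegularLoop.exists_isGoodScale {c : ℝ → ℂ} (hc : IsRegularLoop c) :
    ∃ δ δ' ε₀ : ℝ, 0 < ε₀ ∧ ∀ ε, 0 < ε → ε ≤ ε₀ → IsGoodScale c ε δ δ' := by
  obtain ⟨δ', hδ', htan⟩ := hc.exists_tangency
  set δ := min (δ' / 2) (1 / 8) with hδ
  have h1 : 0 < δ := by positivity
  have h2 : δ ≤ δ' / 2 := min_le_left _ _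
  have h3 : δ ≤ 1 / 8 := min_le_right _ _
  obtain ⟨κ₁, hκ₁, hsep₁⟩ := hc.exists_separation (δ := 2 * δ) (by positivity)
  obtain ⟨κ₂, hκ₂, hsep₂⟩ := hc.exists_separation (δ := δ' - δ) (by linarith)
  refine ⟨δ, δ', min κ₁ κ₂ / 4, by positivity, fun ε hε hε0 => ?_⟩
  have h4 : ε ≤ κ₁ / 4 := by linarith [min_le_left κ₁ κ₂]
  have h5 : ε ≤ κ₂ / 4 := by linarith [min_le_right κ₁ κ₂]
  refine ⟨hε, ?_, by linarith, htan, fun t t' h => hsep₂ t t' (by linarith)⟩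
  have hchord : ∀ x s, chordSq c (x + 1 / 2, 1 / 2 - s) = chordSq c (x, s) := fun x s => by
    simp only [chordSq, hc.chord_add_half, Complex.normSq_neg]
  change IsCollar (fun p => chordSq c p / ε ^ 2) δ
  refine ⟨hc.contDiff_chordSq.div_const _, fun x => ?_, h1, h3, fun x s hs0 hs => ?_,
    fun x s hs hs' => ?_, fun x s => ?_, fun x s => ?_⟩
  · simp [chordSq, chord]
  · have e1 := hasDerivAt_snd_of_differentiableAt
      (hc.contDiff_chordSq.differentiable (by simp) (x, s))
    have e2 := hasDerivAt_snd_of_differentiableAt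
      ((hc.contDiff_chordSq.div_const (ε ^ 2)).differentiable (by simp) (x, s))
    rw [e2.unique (e1.div_const (ε ^ 2)), hc.fderiv_chordSq, hc.chord_eq]
    have e3 := (htan x 0 s (by simpa using hδ') (by rw [abs_of_pos hs0]; linarith)).1
    have e4 : dot (s * chordSlope c x s) (dsum c x s) = s * dot (chordSlope c x s) (dsum c x s) := by
      simp only [dot, Complex.re_ofReal_mul, Complex.im_ofReal_mul]
      ring
    rw [e4]
    positivity
  · have e1 : κ₁ ≤ ‖c (x - s) - c (x + s)‖ := by
      by_contra! hcon
      obtain ⟨n, hn⟩ := hsep₁ _ _ hcon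
      rw [abs_lt] at hn
      have e2 : (0 : ℝ) < n := by linarith [hn.2]
      have e3 : (n : ℝ) < 1 := by linarith [hn.1]
      have e4 : 0 < n := by exact_mod_cast e2
      have e5 : n < 1 := by exact_mod_cast e3
      omega
    have e2 : ‖chord c x s‖ = ‖c (x - s) - c (x + s)‖ / 2 := by
      rw [chord, norm_div, norm_sub_rev]; simp
    rw [le_div_iff₀ (by positivity), ← sq_norm_chord]
    have e3 : 2 * ε ≤ ‖chord c x s‖ := by linarith
    nlinarith
  · simp only [hchord]
  · simp [chordSq, hc.chord_add_one]

/-! ### The closed curve of label and twist -/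

section Angle
open Real

/-- The cosine of the angle coordinate on the second circle factor, centred at `1 / 8`. -/
def cs (y : ℝ) : ℝ := cos (2 * π * (y - 1 / 8))

/-- The sine of the angle coordinate on the second circle factor, centred at `1 / 8`. -/
def sn (y : ℝ) : ℝ := sin (2 * π * (y - 1 / 8))

/-- The label of the slice of `L` over `y`. -/
def label (y : ℝ) : ℝ := 9 / 4 - 5 * √2 / 4 * cs y

/-- The fraction of the rotation angle applied over `y`. -/
def twist (y : ℝ) : ℝ := smoothTransition (1 / 2 - sn y / √2)

theorem cs_sq_add_sn_sq (y : ℝ) : cs y ^ 2 + sn y ^ 2 = 1 := cos_sq_add_sin_sq _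

theorem cs_add_one (y : ℝ) : cs (y + 1) = cs y := by
  rw [cs, show 2 * π * (y + 1 - 1 / 8) = 2 * π * (y - 1 / 8) + 2 * π by ring, cos_add_two_pi, cs]

theorem sn_add_one (y : ℝ) : sn (y + 1) = sn y := by
  rw [sn, show 2 * π * (y + 1 - 1 / 8) = 2 * π * (y - 1 / 8) + 2 * π by ring, sin_add_two_pi, sn]

theorem cs_reflect (y : ℝ) : cs (3 / 4 - y) = -cs y := by
  rw [cs, show 2 * π * (3 / 4 - y - 1 / 8) = π - 2 * π * (y - 1 / 8) by ring, cos_pi_sub, cs]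

theorem sn_reflect (y : ℝ) : sn (3 / 4 - y) = sn y := by
  rw [sn, show 2 * π * (3 / 4 - y - 1 / 8) = π - 2 * π * (y - 1 / 8) by ring, sin_pi_sub, sn]

theorem label_add_one (y : ℝ) : label (y + 1) = label y := by rw [label, cs_add_one, label]

theorem twist_add_one (y : ℝ) : twist (y + 1) = twist y := by rw [twist, sn_add_one, twist]

theorem label_reflect (y : ℝ) : label (3 / 4 - y) = 9 / 2 - label y := by
  rw [label, cs_reflect, label]
  ring

theorem twist_reflect (y : ℝ) : twist (3 / 4 - y) = twist y := by rw [twist, sn_reflect, twist]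

theorem eq_add_int_of_cs_sn {y y' : ℝ} (h1 : cs y = cs y') (h2 : sn y = sn y') :
    ∃ n : ℤ, y' = y + n := by
  have h := Real.Angle.cos_sin_inj h1 h2
  obtain ⟨k, hk⟩ := Real.Angle.angle_eq_iff_two_pi_dvd_sub.1 h
  refine ⟨-k, ?_⟩
  have hpi := pi_pos
  have : 2 * π * (y - y' - k) = 0 := by linarith
  have : y - y' - k = 0 := by simpa [hpi.ne'] using this
  push_cast
  linarith

theorem le_cos_of_abs_le {a : ℝ} (h : |a| ≤ 1 / 8) : √2 / 2 ≤ cos (2 * π * a) := by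
  have hpi := pi_pos
  rw [← cos_pi_div_four, ← cos_abs (2 * π * a), abs_mul, abs_of_pos (by positivity : 0 < 2 * π)]
  have := abs_nonneg a
  exact cos_le_cos_of_nonneg_of_le_pi (by positivity) (by linarith) (by nlinarith)

theorem lt_cos_of_abs_lt {a : ℝ} (h : |a| < 1 / 8) : √2 / 2 < cos (2 * π * a) := by
  have hpi := pi_pos
  rw [← cos_pi_div_four, ← cos_abs (2 * π * a), abs_mul, abs_of_pos (by positivity : 0 < 2 * π)]
  have := abs_nonneg a
  exact cos_lt_cos_of_nonneg_of_le_pi (by positivity) (by linarith) (by nlinarith)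

theorem sn_eq (y : ℝ) : sn y = cos (2 * π * (y - 3 / 8)) := by
  rw [sn, ← cos_sub_pi_div_two]; congr 1; ring

theorem neg_sn_eq (y : ℝ) : -sn y = cos (2 * π * (y - 7 / 8)) := by
  rw [sn, ← sin_sub_pi, ← cos_sub_pi_div_two, ← cos_add_two_pi]
  rw [← cos_sub_two_pi]; congr 1; ring

theorem le_sn {y : ℝ} (h : y ∈ Icc (1 / 4 : ℝ) (1 / 2)) : √2 / 2 ≤ sn y := by
  rw [sn_eq]
  exact le_cos_of_abs_le (abs_le.2 ⟨by linarith [h.1], by linarith [h.2]⟩)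

theorem sn_le {y : ℝ} (h : y ∈ Icc (3 / 4 : ℝ) 1) : sn y ≤ -(√2 / 2) := by
  have : √2 / 2 ≤ -sn y := by
    rw [neg_sn_eq]
    exact le_cos_of_abs_le (abs_le.2 ⟨by linarith [h.1], by linarith [h.2]⟩)
  linarith

theorem le_cs {y : ℝ} (h : y ∈ Icc (0 : ℝ) (1 / 4)) : √2 / 2 ≤ cs y :=
  le_cos_of_abs_le (abs_le.2 ⟨by linarith [h.1], by linarith [h.2]⟩)

theorem lt_cs {y : ℝ} (h : y ∈ Ioo (0 : ℝ) (1 / 4)) : √2 / 2 < cs y :=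
  lt_cos_of_abs_lt (abs_lt.2 ⟨by linarith [h.1], by linarith [h.2]⟩)

theorem sqrt_two_sq : √2 * √2 = 2 := Real.mul_self_sqrt (by norm_num)

theorem sqrt_two_lt : √2 < 3 / 2 := by
  rw [Real.sqrt_lt' (by norm_num)]
  norm_num

/-- The amplitude `5√2/4` is less than `15/8 < 9/4`, so the curve turns round before reaching either
end of the annulus. -/
theorem label_mem (y : ℝ) : label y ∈ Ioo (0 : ℝ) (9 / 2) := by
  have h1 := neg_one_le_cos (2 * π * (y - 1 / 8))
  have h2 := cos_le_one (2 * π * (y - 1 / 8))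
  have h3 := sqrt_two_lt
  have h4 : 0 < √2 := by positivity
  unfold label cs
  constructor <;> nlinarith

/-- The amplitude is such that `cs = √2/2`, which happens at `y = 0` and `y = 1/4`, gives `9/4 - 5/4
= 1`, the boundary of the collar. -/
theorem label_le_one_iff {y : ℝ} : label y ≤ 1 ↔ √2 / 2 ≤ cs y := by
  have h4 : 0 < √2 := by positivity
  have h5 := sqrt_two_sq
  unfold label
  constructor <;> intro h <;> nlinarith

theorem label_lt_one_iff {y : ℝ} : label y < 1 ↔ √2 / 2 < cs y := by
  have h4 : 0 < √2 := by positivity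
  have h5 := sqrt_two_sq
  unfold label
  constructor <;> intro h <;> nlinarith

theorem label_lt_one {y : ℝ} (h : y ∈ Ioo (0 : ℝ) (1 / 4)) : label y < 1 :=
  label_lt_one_iff.2 (lt_cs h)

theorem label_le_one {y : ℝ} (h : y ∈ Icc (0 : ℝ) (1 / 4)) : label y ≤ 1 :=
  label_le_one_iff.2 (le_cs h)

theorem label_mem_of_le_abs_sn {y : ℝ} (h : √2 / 2 ≤ |sn y|) :
    label y ∈ Icc (1 : ℝ) (7 / 2) := by
  have h4 : 0 < √2 := by positivity
  have h5 := sqrt_two_sq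
  have h6 := cs_sq_add_sn_sq y
  rw [← sq_abs (sn y)] at h6
  have h7 : cs y ^ 2 ≤ (√2 / 2) ^ 2 := by nlinarith
  have h8 := abs_le.1 (abs_le_of_sq_le_sq h7 (by positivity))
  unfold label
  constructor <;> nlinarith

theorem label_quarter : label (1 / 4) = 1 := by
  rw [label, cs, show 2 * π * (1 / 4 - 1 / 8) = π / 4 by ring, cos_pi_div_four]
  linarith [sqrt_two_sq]

theorem continuous_label : Continuous label := by
  unfold label cs
  fun_prop

theorem exists_label_eq_left {v : ℝ} (hv : v ∈ Icc (1 : ℝ) (7 / 2)) :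
    ∃ y ∈ Icc (1 / 4 : ℝ) (1 / 2), label y = v := by
  have h2 : label (1 / 2) = 7 / 2 := by
    have := label_reflect (1 / 4)
    rw [label_quarter] at this
    norm_num at this
    rw [this]
  have := intermediate_value_Icc (a := (1 / 4 : ℝ)) (b := 1 / 2) (by norm_num)
    continuous_label.continuousOn
  rw [label_quarter, h2] at this
  exact this hv

theorem exists_label_eq_right {v : ℝ} (hv : v ∈ Icc (1 : ℝ) (7 / 2)) :
    ∃ y ∈ Icc (3 / 4 : ℝ) 1, label y = v := by
  obtain ⟨y, hy, h⟩ := exists_label_eq_left hv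
  refine ⟨1 / 4 - y + 1, ⟨by linarith [hy.2], by linarith [hy.1]⟩, ?_⟩
  rw [label_add_one, ← h, label, label, cs, cs, ← cos_neg]
  congr 3
  ring

theorem cs_eq_of_label_eq {y y' : ℝ} (h : label y = label y') : cs y = cs y' := by
  have h4 : (5 * √2 / 4) ≠ 0 := by positivity
  unfold label at h
  exact mul_left_cancel₀ h4 (by linarith)

theorem twist_of_le_sn {y : ℝ} (h : √2 / 2 ≤ sn y) : twist y = 0 := by
  have h4 : 0 < √2 := by positivity
  refine smoothTransition.zero_of_nonpos ?_
  rw [sub_nonpos, le_div_iff₀ h4]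
  linarith

theorem twist_of_sn_le {y : ℝ} (h : sn y ≤ -(√2 / 2)) : twist y = 1 := by
  have h4 : 0 < √2 := by positivity
  refine smoothTransition.one_of_one_le ?_
  have : sn y / √2 ≤ -(1 / 2) := by
    rw [div_le_iff₀ h4]
    linarith
  linarith

theorem twist_mem (y : ℝ) : twist y ∈ Icc (0 : ℝ) 1 :=
  ⟨smoothTransition.nonneg _, smoothTransition.le_one _⟩

/-- On a cap `|sn| ≤ √2/2`, so the argument of the smooth step stays in `[0, 1]`, where the step is
injective. -/
theorem sn_eq_of_twist_eq {y y' : ℝ} (h1 : √2 / 2 ≤ cs y) (h2 : √2 / 2 ≤ cs y')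
    (h : twist y = twist y') : sn y = sn y' := by
  have h4 : 0 < √2 := by positivity
  have key : ∀ y, √2 / 2 ≤ cs y → 1 / 2 - sn y / √2 ∈ Icc (0 : ℝ) 1 := by
    intro y hy
    have h5 := sqrt_two_sq
    have h6 := cs_sq_add_sn_sq y
    have h7 : sn y ^ 2 ≤ (√2 / 2) ^ 2 := by nlinarith
    have h8 := abs_le.1 (abs_le_of_sq_le_sq h7 (by positivity))
    have h9 : sn y / √2 ≤ 1 / 2 := by rw [div_le_iff₀ h4]; linarith
    have h10 : -(1 / 2) ≤ sn y / √2 := by rw [le_div_iff₀ h4]; linarith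
    constructor <;> linarith
  have := smoothTransition_strictMonoOn.injOn (key y h1) (key y' h2) h
  have h3 : sn y / √2 = sn y' / √2 := by linarith
  field_simp at h3
  exact h3

theorem contDiff_label : ContDiff ℝ ∞ label := by
  unfold label cs
  exact contDiff_const.sub (contDiff_const.mul (contDiff_cos.comp (by fun_prop)))

theorem contDiff_twist : ContDiff ℝ ∞ twist := by
  unfold twist sn
  exact smoothTransition.contDiff.comp
    (contDiff_const.sub ((contDiff_sin.comp (by fun_prop)).div_const _))

theorem hasDerivAt_label (y : ℝ) : HasDerivAt label (5 * √2 / 4 * (2 * π) * sn y) y := by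
  have h1 : HasDerivAt (fun y : ℝ => 2 * π * (y - 1 / 8)) (2 * π) y :=
    (((hasDerivAt_id y).sub_const (1 / 8)).const_mul (2 * π)).congr_deriv (mul_one _)
  refine ((h1.cos.const_mul (5 * √2 / 4)).const_sub (9 / 4)).congr_deriv ?_
  rw [sn]
  ring

theorem hasDerivAt_twist (y : ℝ) :
    HasDerivAt twist (deriv smoothTransition (1 / 2 - sn y / √2) * (-(cs y * (2 * π)) / √2)) y := by
  have h1 : HasDerivAt (fun y : ℝ => 2 * π * (y - 1 / 8)) (2 * π) y :=
    (((hasDerivAt_id y).sub_const (1 / 8)).const_mul (2 * π)).congr_deriv (mul_one _)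
  have h2 := (h1.sin.div_const √2).const_sub (1 / 2)
  refine ((differentiable_smoothTransition _).hasDerivAt.comp y h2).congr_deriv ?_
  simp only [cs, sn]
  ring

/-- The step has zero slope unless its argument is strictly between `0` and `1`, that is `|sn| <
√2/2`, hence `|cs| > √2/2`. So rotation varies only inside the two collars. -/
theorem label_of_deriv_twist_ne_zero {y : ℝ} (h : deriv twist y ≠ 0) :
    label y < 1 ∨ 7 / 2 < label y := by
  have h4 : 0 < √2 := by positivity
  have h5 := sqrt_two_sq
  rw [(hasDerivAt_twist y).deriv] at h
  have h1 := left_ne_zero_of_mul h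
  have h2 : 0 < 1 / 2 - sn y / √2 := by
    by_contra! hc
    exact h1 (deriv_smoothTransition_of_nonpos hc)
  have h3 : 1 / 2 - sn y / √2 < 1 := by
    by_contra! hc
    exact h1 (deriv_smoothTransition_of_one_le hc)
  have h6 : sn y / √2 < 1 / 2 := by linarith
  have h7 : -(1 / 2) < sn y / √2 := by linarith
  rw [div_lt_iff₀ h4] at h6
  rw [lt_div_iff₀ h4] at h7
  have h8 : (√2 / 2) ^ 2 < cs y ^ 2 := by nlinarith [cs_sq_add_sn_sq y]
  have h10 : √2 / 2 < |cs y| :=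
    lt_of_pow_lt_pow_left₀ 2 (abs_nonneg _) (by rwa [sq_abs])
  rcases lt_abs.1 h10 with h9 | h9
  · left
    exact label_lt_one_iff.2 h9
  · right
    unfold label
    nlinarith

theorem deriv_twist_ne_zero {y : ℝ} (h : sn y = 0) : deriv twist y ≠ 0 := by
  have h4 : 0 < √2 := by positivity
  have h6 := cs_sq_add_sn_sq y
  have h7 : cs y ≠ 0 := by
    rintro h0
    rw [h, h0] at h6
    norm_num at h6
  rw [(hasDerivAt_twist y).deriv, h, zero_div, sub_zero]
  refine mul_ne_zero deriv_smoothTransition_half_ne_zero ?_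
  exact div_ne_zero (neg_ne_zero.2 (mul_ne_zero h7 (by positivity))) h4.ne'

end Angle

/-! ### Midpoints along curves of constant chord length -/

theorem IsCollar.slice_add_int {q : ℝ × ℝ → ℝ} {δ : ℝ} (h : IsCollar q δ) (x v : ℝ) (n : ℤ) :
    IsCollar.slice q (x + n, v) = IsCollar.slice q (x, v) := by
  have h1 : Function.Periodic (fun x => IsCollar.slice q (x, v)) 1 := fun x => h.slice_periodic x v
  have := h1.int_mul n x
  rwa [mul_one] at this

theorem IsRegularLoop.mid_add_int {c : ℝ → ℂ} (hc : IsRegularLoop c) (x s : ℝ) (n : ℤ) :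
    mid c (x + n) s = mid c x s := by
  have h1 : Function.Periodic (fun x => mid c x s) 1 := fun x => hc.mid_add_one x s
  have := h1.int_mul n x
  rwa [mul_one] at this

namespace IsGoodScale

variable {ε δ δ' : ℝ} {c : ℝ → ℂ}

/-- Along a curve `s = s(x)` of constant chord length near the diagonal, the midpoint moves in the
direction of the nearby tangents of `c`. -/
theorem dot_deriv_pos (hs : IsGoodScale c ε δ δ') (hc : IsRegularLoop c) {x u s s' : ℝ}
    (h0 : 0 < s) (h1 : s < δ') (hu : |u| < δ')
    (h : dot (chord c (x + u) s) (ddiff c (x + u) s + s' • dsum c (x + u) s) = 0) :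
    0 < dot (deriv c x) (dsum c (x + u) s + s' • ddiff c (x + u) s) := by
  have habs : |s| < δ' := by rwa [abs_of_pos h0]
  have hP := (hs.tangency (x + u) 0 s (by simpa using h0.trans h1) habs).1
  have hT := (hs.tangency x u s hu habs).2
  rw [hc.chord_eq] at h
  set k := chordSlope c (x + u) s
  set A := dsum c (x + u) s
  set B := ddiff c (x + u) s
  have h2 : dot k B = -(s' * dot k A) := by
    -- The half chord is `s * k`, so constancy of its length reads `k·B = -s' k·A` after division by
    -- `s`. With this, the tangency vector is `k·A` times the velocity of the midpoint.
    have : s * (dot k B + s' * dot k A) = 0 := by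
      rw [← h]
      simp only [dot, Complex.re_ofReal_mul, Complex.im_ofReal_mul, Complex.add_re,
        Complex.add_im, Complex.smul_re, Complex.smul_im, smul_eq_mul]
      ring
    have := (mul_eq_zero.1 this).resolve_left h0.ne'
    linarith
  rw [h2] at hT
  have h3 : dot (deriv c x) (dot k A • A - -(s' * dot k A) • B) =
      dot k A * dot (deriv c x) (A + s' • B) := by
    generalize dot k A = m
    simp only [dot, Complex.add_re, Complex.add_im, Complex.sub_re, Complex.sub_im,
      Complex.smul_re, Complex.smul_im, smul_eq_mul]
    ring
  rw [h3] at hT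
  exact pos_of_mul_pos_right hT hP.le

theorem chordSq_eq (hs : IsGoodScale c ε δ δ') (p : ℝ × ℝ) :
    chordSq c p = ε ^ 2 * scaledSq c ε p := by
  have := hs.pos
  rw [scaledSq]
  field_simp

theorem hasDerivAt_slice_fst (hs : IsGoodScale c ε δ δ') (x : ℝ) {v : ℝ}
    (hv : v ∈ Ioo (0 : ℝ) (9 / 2)) :
    HasDerivAt (fun x => IsCollar.slice (scaledSq c ε) (x, v))
      (fderiv ℝ (IsCollar.slice (scaledSq c ε)) (x, v) (1, 0)) x :=
  hasDerivAt_fst_of_differentiableAt ((hs.collar.contDiffAt_slice x hv).differentiableAt (by simp))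

/-- For labels up to `5/4` the squared half chord along the slice is the constant `ε² v`; this is
its derivative. -/
theorem dot_chord_eq_zero (hs : IsGoodScale c ε δ δ') (hc : IsRegularLoop c) (x : ℝ) {v s' : ℝ}
    (h0 : 0 < v) (h1 : v ≤ 5 / 4)
    (hd : HasDerivAt (fun x => IsCollar.slice (scaledSq c ε) (x, v)) s' x) :
    dot (chord c x (IsCollar.slice (scaledSq c ε) (x, v)))
      (ddiff c x (IsCollar.slice (scaledSq c ε) (x, v)) +
        s' • dsum c x (IsCollar.slice (scaledSq c ε) (x, v))) = 0 := by
  have h2 := hasDerivAt_normSq (hc.hasDerivAt_chord (hasDerivAt_id x) hd)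
  have h3 : (fun t => Complex.normSq (chord c (id t) (IsCollar.slice (scaledSq c ε) (t, v)))) =
      fun _ => ε ^ 2 * v := by
    ext t
    have := hs.chordSq_eq (t, IsCollar.slice (scaledSq c ε) (t, v))
    rwa [(hs.collar.slice_of_le t h0 h1).1] at this
  rw [h3] at h2
  have := h2.unique (hasDerivAt_const x _)
  simpa using this

/-- On the collar, a point of a slice is determined by its midpoint. -/
theorem mid_slice_injective (hs : IsGoodScale c ε δ δ') (hc : IsRegularLoop c) {x x' v : ℝ}
    (h0 : 0 < v) (h1 : v ≤ 5 / 4)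
    (h : mid c x (IsCollar.slice (scaledSq c ε) (x, v)) =
      mid c x' (IsCollar.slice (scaledSq c ε) (x', v))) : ∃ n : ℤ, x' = x + n := by
  have hε := hs.pos
  have hv : v ∈ Ioo (0 : ℝ) (9 / 2) := ⟨h0, by linarith⟩
  set σ : ℝ → ℝ := fun x => IsCollar.slice (scaledSq c ε) (x, v) with hσ
  change mid c x (σ x) = mid c x' (σ x') at h
  have hpos : ∀ x, 0 < σ x := fun x => (hs.collar.slice_mem x hv).1
  have hlt : ∀ x, σ x < δ := fun x => (hs.collar.slice_of_le x h0 h1).2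
  have hnorm : ∀ x, ‖chord c x (σ x)‖ < 2 * ε := by
    intro x
    have e1 := sq_norm_chord c x (σ x)
    rw [hs.chordSq_eq, (hs.collar.slice_of_le x h0 h1).1] at e1
    refine lt_of_pow_lt_pow_left₀ 2 (by positivity) ?_
    rw [e1]
    nlinarith [pow_pos hε 2]
  have hend : ∀ x, c (x + σ x) = mid c x (σ x) + chord c x (σ x) := by
    intro x
    unfold mid chord
    ring
  -- Equal midpoints and half chords shorter than `2 ε` bring the end points within `4 ε`, so after
  -- an integer shift the parameters `x` and `x'` differ by less than `δ'`.
  have hclose : ‖c (x + σ x) - c (x' + σ x')‖ < 4 * ε := by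
    rw [hend, hend, h, add_sub_add_left_eq_sub]
    calc _ ≤ _ := norm_sub_le _ _
      _ < 4 * ε := by linarith [hnorm x, hnorm x']
  obtain ⟨n, hn⟩ := hs.separation _ _ hclose
  refine ⟨n, ?_⟩
  have hper : σ (x' - n) = σ x' := by
    have := hs.collar.slice_add_int (x' - n) v n
    rw [sub_add_cancel] at this
    exact this.symm
  have hmid : mid c (x' - n) (σ (x' - n)) = mid c x' (σ x') := by
    rw [hper, ← hc.mid_add_int (x' - n) _ n, sub_add_cancel]
  have hdist : |x' - n - x| < δ' := by
    have e1 := hpos x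
    have e2 := hpos x'
    have e3 := hlt x
    have e4 := hlt x'
    rw [abs_lt] at hn ⊢
    constructor <;> linarith [hn.1, hn.2]
  have hder : ∀ t, HasDerivAt (fun t => dot (deriv c x) (mid c t (σ t)))
      (dot (deriv c x) (dsum c t (σ t) +
        fderiv ℝ (IsCollar.slice (scaledSq c ε)) (t, v) (1, 0) • ddiff c t (σ t))) t := by
    intro t
    have e1 := hc.hasDerivAt_mid (hasDerivAt_id t) (hs.hasDerivAt_slice_fst t hv)
    have e2 := Complex.reCLM.hasFDerivAt.comp_hasDerivAt t e1
    have e3 := Complex.imCLM.hasFDerivAt.comp_hasDerivAt t e1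
    refine ((e2.const_mul (deriv c x).re).add (e3.const_mul (deriv c x).im)).congr_deriv ?_
    simp [dot, hσ]
  -- The midpoint is projected on one fixed tangent `c'(x)`; on the whole `δ'`-window its velocity
  -- has positive component in that direction.
  have hmono : StrictMonoOn (fun t => dot (deriv c x) (mid c t (σ t)))
      (Ioo (x - δ') (x + δ')) := by
    refine strictMonoOn_of_deriv_pos (convex_Ioo _ _)
      (fun t _ => (hder t).continuousAt.continuousWithinAt) fun t ht => ?_
    rw [interior_Ioo] at ht
    rw [(hder t).deriv]
    have e1 := hs.dot_chord_eq_zero hc t h0 h1 (hs.hasDerivAt_slice_fst t hv)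
    have e2 := hs.dot_deriv_pos hc (x := x) (u := t - x) (hpos t) ((hlt t).trans hs.lt)
      (abs_lt.2 ⟨by linarith [ht.1], by linarith [ht.2]⟩)
      (s' := fderiv ℝ (IsCollar.slice (scaledSq c ε)) (t, v) (1, 0))
    rw [add_sub_cancel] at e2
    exact e2 e1
  rw [abs_lt] at hdist
  have := hmono.injOn (x₁ := x) (x₂ := x' - n)
    ⟨by linarith [hpos x, hlt x, hs.lt], by linarith [hpos x, hlt x, hs.lt]⟩
    ⟨by linarith [hdist.1], by linarith [hdist.2]⟩ (by simp only [h, hmid])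
  linarith

end IsGoodScale

/-! ### The surface: smooth, Lagrangian, immersed -/

/-- The half distance of the parameters of the chord used at the point `p` of the torus. -/
def depth (c : ℝ → ℂ) (ε : ℝ) (p : ℝ × ℝ) : ℝ := IsCollar.slice (scaledSq c ε) (p.1, label p.2)

/-- The half chord used at the point `p` of the torus. -/
def fiber (c : ℝ → ℂ) (ε : ℝ) (p : ℝ × ℝ) : ℂ := chord c p.1 (depth c ε p)

/-- The rotation angle used at the point `p` of the torus. -/
def phase (c : ℝ → ℂ) (ε : ℝ) (φ : ℝ → ℝ) (p : ℝ × ℝ) : ℝ :=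
  twist p.2 * φ (2 * ‖fiber c ε p‖)

/-- The lift to the plane of the immersed torus. -/
def surface (c : ℝ → ℂ) (ε : ℝ) (φ : ℝ → ℝ) (p : ℝ × ℝ) : ℂ × ℂ :=
  (mid c p.1 (depth c ε p), Complex.exp (phase c ε φ p * Complex.I) * fiber c ε p)

theorem IsRegularLoop.chord_ne_zero {c : ℝ → ℂ} (hc : IsRegularLoop c) {x s : ℝ}
    (hs : s ∈ Ioo (0 : ℝ) (1 / 2)) : chord c x s ≠ 0 := by
  intro h
  have h1 : c (x - s) = c (x + s) := by
    unfold chord at h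
    have : c (x + s) - c (x - s) = 0 := by simpa using h
    rw [sub_eq_zero] at this
    exact this.symm
  obtain ⟨n, hn⟩ := hc.inj _ _ h1
  have h2 : (0 : ℝ) < n := by linarith [hs.1]
  have h3 : (n : ℝ) < 1 := by linarith [hs.2]
  have h4 : 0 < n := by exact_mod_cast h2
  have h5 : n < 1 := by exact_mod_cast h3
  omega

/-- Rotating both vectors does not change the area they span. -/
theorem area_mul (e a b : ℂ) : (e * a).re * (e * b).im - (e * a).im * (e * b).re =
    Complex.normSq e * (a.re * b.im - a.im * b.re) := by
  simp only [Complex.mul_re, Complex.mul_im, Complex.normSq_apply]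
  ring

theorem normSq_exp_mul_I (t : ℝ) : Complex.normSq (Complex.exp (t * Complex.I)) = 1 := by
  rw [Complex.normSq_eq_norm_sq, Complex.norm_exp_ofReal_mul_I, one_pow]

/-- The derivative of the half chord at `p` in the direction `a`. -/
def dfiber (c : ℝ → ℂ) (ε : ℝ) (p a : ℝ × ℝ) : ℂ :=
  a.1 • ddiff c p.1 (depth c ε p) + fderiv ℝ (depth c ε) p a • dsum c p.1 (depth c ε p)

namespace IsGoodScale

variable {c : ℝ → ℂ} {ε δ δ' : ℝ} {φ : ℝ → ℝ}

theorem depth_mem (hs : IsGoodScale c ε δ δ') (p : ℝ × ℝ) :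
    depth c ε p ∈ Ioo (0 : ℝ) (1 / 2) := hs.collar.slice_mem _ (label_mem _)

theorem fiber_ne_zero (hs : IsGoodScale c ε δ δ') (hc : IsRegularLoop c) (p : ℝ × ℝ) :
    fiber c ε p ≠ 0 := hc.chord_ne_zero (hs.depth_mem p)

theorem contDiff_depth (hs : IsGoodScale c ε δ δ') : ContDiff ℝ ∞ (depth c ε) := by
  rw [contDiff_iff_contDiffAt]
  rintro ⟨x, y⟩
  have h : ContDiffAt ℝ ∞ (fun p : ℝ × ℝ => (p.1, label p.2)) (x, y) :=
    contDiffAt_fst.prodMk (contDiff_label.comp contDiff_snd).contDiffAt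
  exact ContDiffAt.comp (g := IsCollar.slice (scaledSq c ε)) (x, y)
    (hs.collar.contDiffAt_slice x (label_mem y)) h

theorem contDiff_fiber (hs : IsGoodScale c ε δ δ') (hc : IsRegularLoop c) :
    ContDiff ℝ ∞ (fiber c ε) := by
  have h1 := hc.contDiff
  have h2 := hs.contDiff_depth
  unfold fiber chord
  exact ((h1.comp (contDiff_fst.add h2)).sub (h1.comp (contDiff_fst.sub h2))).div_const 2

theorem contDiffAt_of_pos (hφ : ContDiffOn ℝ ∞ φ (Ici 0)) {r : ℝ} (hr : 0 < r) :
    ContDiffAt ℝ ∞ φ r := hφ.contDiffAt (Ici_mem_nhds hr)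

/-- Since the half chord never vanishes, its norm is smooth and `φ` is evaluated only in the
interior of `[0, ∞)`. -/
theorem contDiff_phase (hs : IsGoodScale c ε δ δ') (hc : IsRegularLoop c)
    (hφ : ContDiffOn ℝ ∞ φ (Ici 0)) : ContDiff ℝ ∞ (phase c ε φ) := by
  rw [contDiff_iff_contDiffAt]
  intro p
  have h0 := hs.fiber_ne_zero hc p
  have h1 : ContDiffAt ℝ ∞ (fun p => 2 * ‖fiber c ε p‖) p :=
    contDiffAt_const.mul ((hs.contDiff_fiber hc).contDiffAt.norm ℝ h0)
  have h2 := contDiffAt_of_pos hφ (r := 2 * ‖fiber c ε p‖) (by positivity)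
  exact (contDiff_twist.comp contDiff_snd).contDiffAt.mul (ContDiffAt.comp p h2 h1)

theorem contDiff_surface (hs : IsGoodScale c ε δ δ') (hc : IsRegularLoop c)
    (hφ : ContDiffOn ℝ ∞ φ (Ici 0)) : ContDiff ℝ ∞ (surface c ε φ) := by
  have h1 := hc.contDiff
  have h2 := hs.contDiff_depth
  have h3 : ContDiff ℝ ∞ fun p => mid c p.1 (depth c ε p) := by
    unfold mid
    exact ((h1.comp (contDiff_fst.add h2)).add (h1.comp (contDiff_fst.sub h2))).div_const 2
  have h4 : ContDiff ℝ ∞ fun p => (phase c ε φ p : ℂ) :=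
    Complex.ofRealCLM.contDiff.comp (hs.contDiff_phase hc hφ)
  exact h3.prodMk ((h4.mul contDiff_const).cexp.mul (hs.contDiff_fiber hc))

theorem fderiv_depth (hs : IsGoodScale c ε δ δ') (p a : ℝ × ℝ) :
    fderiv ℝ (depth c ε) p a =
      a.1 * fderiv ℝ (IsCollar.slice (scaledSq c ε)) (p.1, label p.2) (1, 0) +
      a.2 * (5 * √2 / 4 * (2 * Real.pi) * sn p.2 *
        fderiv ℝ (IsCollar.slice (scaledSq c ε)) (p.1, label p.2) (0, 1)) := by
  have h1 := ((hs.collar.contDiffAt_slice p.1 (label_mem p.2)).differentiableAt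
    (by simp)).hasFDerivAt
  have h2 : HasFDerivAt (fun p : ℝ × ℝ => label p.2)
      ((5 * √2 / 4 * (2 * Real.pi) * sn p.2) • ContinuousLinearMap.snd ℝ ℝ ℝ) p :=
    (hasDerivAt_label p.2).comp_hasFDerivAt p hasFDerivAt_snd
  have h3 : HasFDerivAt (depth c ε) _ p :=
    HasFDerivAt.comp (g := IsCollar.slice (scaledSq c ε)) p h1 (hasFDerivAt_fst.prodMk h2)
  rw [h3.fderiv]
  set B := fderiv ℝ (IsCollar.slice (scaledSq c ε)) (p.1, label p.2)
  change B (a.1, 5 * √2 / 4 * (2 * Real.pi) * sn p.2 * a.2) = _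
  have h4 : ∀ u v : ℝ, B (u, v) = u * B (1, 0) + v * B (0, 1) := by
    intro u v
    have : (u, v) = u • ((1 : ℝ), (0 : ℝ)) + v • ((0 : ℝ), (1 : ℝ)) := by simp
    rw [this, map_add, map_smul, map_smul, smul_eq_mul, smul_eq_mul]
  rw [h4]
  ring

theorem hasDerivAt_line_fst (p a : ℝ × ℝ) : HasDerivAt (fun t : ℝ => (p + t • a).1) a.1 0 := by
  simpa using ((hasDerivAt_id (0 : ℝ)).mul_const a.1).const_add p.1

theorem hasDerivAt_line_snd (p a : ℝ × ℝ) : HasDerivAt (fun t : ℝ => (p + t • a).2) a.2 0 := by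
  simpa using ((hasDerivAt_id (0 : ℝ)).mul_const a.2).const_add p.2

theorem hasDerivAt_depth_line (hs : IsGoodScale c ε δ δ') (p a : ℝ × ℝ) :
    HasDerivAt (fun t : ℝ => depth c ε (p + t • a)) (fderiv ℝ (depth c ε) p a) 0 :=
  (hs.contDiff_depth.differentiable (by simp) p).hasFDerivAt.hasLineDerivAt a

theorem hasDerivAt_fiber_line (hs : IsGoodScale c ε δ δ') (hc : IsRegularLoop c) (p a : ℝ × ℝ) :
    HasDerivAt (fun t : ℝ => fiber c ε (p + t • a)) (dfiber c ε p a) 0 := by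
  refine (hc.hasDerivAt_chord (hasDerivAt_line_fst p a)
    (hs.hasDerivAt_depth_line p a)).congr_deriv ?_
  simp only [zero_smul, add_zero]
  rfl

theorem hasDerivAt_normSq_fiber_line (hs : IsGoodScale c ε δ δ') (hc : IsRegularLoop c)
    (p a : ℝ × ℝ) : HasDerivAt (fun t : ℝ => Complex.normSq (fiber c ε (p + t • a)))
      (2 * dot (fiber c ε p) (dfiber c ε p a)) 0 := by
  refine (hasDerivAt_normSq (hs.hasDerivAt_fiber_line hc p a)).congr_deriv ?_
  simp only [zero_smul, add_zero]

/-- Only the part of `dα` coming from the twist matters; the part through `φ (2 |w|)` is a multiple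
of `d|w|²`, and its coefficient `m` need not be known. -/
theorem fderiv_phase (hs : IsGoodScale c ε δ δ') (hc : IsRegularLoop c)
    (hφ : ContDiffOn ℝ ∞ φ (Ici 0)) (p : ℝ × ℝ) : ∃ m : ℝ, ∀ a : ℝ × ℝ,
    fderiv ℝ (phase c ε φ) p a = deriv twist p.2 * a.2 * φ (2 * ‖fiber c ε p‖) +
      m * dot (fiber c ε p) (dfiber c ε p a) := by
  have h0 := hs.fiber_ne_zero hc p
  have hpos : 0 < 2 * ‖fiber c ε p‖ := by positivity
  refine ⟨twist p.2 * (deriv φ (2 * ‖fiber c ε p‖) * (2 * (2 / (2 * ‖fiber c ε p‖)))),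
    fun a => ?_⟩
  have h1 : HasDerivAt (fun t : ℝ => phase c ε φ (p + t • a)) (fderiv ℝ (phase c ε φ) p a) 0 :=
    ((hs.contDiff_phase hc hφ).differentiable (by simp) p).hasFDerivAt.hasLineDerivAt a
  have h2 := (hs.hasDerivAt_normSq_fiber_line hc p a).sqrt
    (by simpa only [zero_smul, add_zero] using (Complex.normSq_pos.2 h0).ne')
  simp only [← Complex.norm_def, zero_smul, add_zero] at h2
  have h3 := h2.const_mul 2
  have h4 : HasDerivAt φ (deriv φ (2 * ‖fiber c ε p‖)) (2 * ‖fiber c ε (p + (0 : ℝ) • a)‖) := by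
    simp only [zero_smul, add_zero]
    exact ((contDiffAt_of_pos hφ hpos).differentiableAt (by simp)).hasDerivAt
  have h5 := HasDerivAt.comp (0 : ℝ) h4 h3
  have h6 : HasDerivAt twist (deriv twist p.2) (p + (0 : ℝ) • a).2 := by
    simp only [zero_smul, add_zero]
    exact (contDiff_twist.differentiable (by simp) p.2).hasDerivAt
  have h7 := (HasDerivAt.comp (0 : ℝ) h6 (hasDerivAt_line_snd p a)).mul h5
  rw [h1.unique h7]
  simp only [Function.comp, zero_smul, add_zero]
  ring

theorem fderiv_surface (hs : IsGoodScale c ε δ δ') (hc : IsRegularLoop c)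
    (hφ : ContDiffOn ℝ ∞ φ (Ici 0)) (p a : ℝ × ℝ) :
    fderiv ℝ (surface c ε φ) p a =
      (a.1 • dsum c p.1 (depth c ε p) + fderiv ℝ (depth c ε) p a • ddiff c p.1 (depth c ε p),
       Complex.exp (phase c ε φ p * Complex.I) *
        (fderiv ℝ (phase c ε φ) p a • (Complex.I * fiber c ε p) + dfiber c ε p a)) := by
  have h1 : HasDerivAt (fun t : ℝ => phase c ε φ (p + t • a)) (fderiv ℝ (phase c ε φ) p a) 0 :=
    ((hs.contDiff_phase hc hφ).differentiable (by simp) p).hasFDerivAt.hasLineDerivAt a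
  have h2 : HasDerivAt (fun t : ℝ => surface c ε φ (p + t • a))
      (fderiv ℝ (surface c ε φ) p a) 0 :=
    ((hs.contDiff_surface hc hφ).differentiable (by simp) p).hasFDerivAt.hasLineDerivAt a
  have h3 := (hc.hasDerivAt_mid (hasDerivAt_line_fst p a) (hs.hasDerivAt_depth_line p a)).prodMk
    ((h1.ofReal_comp.mul_const Complex.I).cexp.mul (hs.hasDerivAt_fiber_line hc p a))
  rw [h2.unique h3]
  simp only [zero_smul, add_zero, Complex.real_smul]
  congr 1
  ring

/-- Where the rotation angle varies, the length of the half chord does not depend on `x`. -/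
theorem exists_dot_dfiber (hs : IsGoodScale c ε δ δ') (hc : IsRegularLoop c) {p : ℝ × ℝ}
    (h : deriv twist p.2 ≠ 0) : ∃ m : ℝ, (sn p.2 ≠ 0 → m ≠ 0) ∧
      ∀ a, dot (fiber c ε p) (dfiber c ε p a) = m * a.2 := by
  have hε := hs.pos
  set d := 5 * √2 / 4 * (2 * Real.pi) * sn p.2 with hd
  have hd0 : sn p.2 ≠ 0 → d ≠ 0 := fun h0 => mul_ne_zero (by positivity) h0
  have hlab : ∀ a, HasDerivAt (fun t : ℝ => label (p + t • a).2) (d * a.2) 0 := by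
    intro a
    have : HasDerivAt label d (p + (0 : ℝ) • a).2 := by
      simp only [zero_smul, add_zero]
      exact hasDerivAt_label p.2
    exact HasDerivAt.comp (h₂ := label) (0 : ℝ) this (hasDerivAt_line_snd p a)
  have hcont : ∀ a, ContinuousAt (fun t : ℝ => label (p + t • a).2) 0 :=
    fun a => (hlab a).continuousAt
  have hval : ∀ q : ℝ × ℝ, Complex.normSq (fiber c ε q) =
      ε ^ 2 * scaledSq c ε (q.1, depth c ε q) := fun q => hs.chordSq_eq (q.1, depth c ε q)
  rcases label_of_deriv_twist_ne_zero h with h1 | h1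
  · refine ⟨ε ^ 2 * d / 2, fun h0 => ?_, fun a => ?_⟩
    · have := hd0 h0
      positivity
    have h2 := ((hlab a).const_mul (ε ^ 2))
    have h3 : (fun t : ℝ => Complex.normSq (fiber c ε (p + t • a))) =ᶠ[𝓝 0]
        fun t => ε ^ 2 * label (p + t • a).2 := by
      have : ∀ᶠ t : ℝ in 𝓝 0, label (p + t • a).2 < 5 / 4 :=
        (hcont a).eventually (Iio_mem_nhds (by simp only [zero_smul, add_zero]; linarith))
      filter_upwards [this] with t ht
      rw [hval, depth, (hs.collar.slice_of_le _ (label_mem _).1 ht.le).1]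
    have h4 := ((hs.hasDerivAt_normSq_fiber_line hc p a).congr_of_eventuallyEq h3.symm).unique h2
    linarith
  · refine ⟨-(ε ^ 2 * d / 2), fun h0 => ?_, fun a => ?_⟩
    · have := hd0 h0
      rw [neg_ne_zero]
      positivity
    have h2 := (((hlab a).const_sub (9 / 2)).const_mul (ε ^ 2))
    have h3 : (fun t : ℝ => Complex.normSq (fiber c ε (p + t • a))) =ᶠ[𝓝 0]
        fun t => ε ^ 2 * (9 / 2 - label (p + t • a).2) := by
      have : ∀ᶠ t : ℝ in 𝓝 0, 13 / 4 < label (p + t • a).2 :=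
        (hcont a).eventually (Ioi_mem_nhds (by simp only [zero_smul, add_zero]; linarith))
      filter_upwards [this] with t ht
      rw [hval, depth, hs.collar.slice_of_ge _ ht.le (label_mem _).2]
    have h4 := ((hs.hasDerivAt_normSq_fiber_line hc p a).congr_of_eventuallyEq h3.symm).unique h2
    linarith

/-- The areas of midpoint and half chord cancel, leaving `dα ∧ d|w|²` up to a factor. If `twist' =
0`, `dα` is a multiple of `d|w|²`; otherwise both are multiples of `dy`. -/
theorem omega_fderiv_surface (hs : IsGoodScale c ε δ δ') (hc : IsRegularLoop c)
    (hφ : ContDiffOn ℝ ∞ φ (Ici 0)) (p a b : ℝ × ℝ) :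
    omega (fderiv ℝ (surface c ε φ) p a) (fderiv ℝ (surface c ε φ) p b) = 0 := by
  obtain ⟨m, hm⟩ := hs.fderiv_phase hc hφ p
  have key : fderiv ℝ (phase c ε φ) p b * dot (fiber c ε p) (dfiber c ε p a) =
      fderiv ℝ (phase c ε φ) p a * dot (fiber c ε p) (dfiber c ε p b) := by
    rw [hm, hm]
    by_cases h : deriv twist p.2 = 0
    · rw [h]; ring
    · obtain ⟨k, -, hk⟩ := hs.exists_dot_dfiber hc h
      rw [hk, hk]; ring
  rw [hs.fderiv_surface hc hφ, hs.fderiv_surface hc hφ]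
  simp only [omega, area_mul, normSq_exp_mul_I, one_mul]
  revert key
  simp only [dfiber, dot]
  generalize fderiv ℝ (phase c ε φ) p a = Pa
  generalize fderiv ℝ (phase c ε φ) p b = Pb
  generalize fderiv ℝ (depth c ε) p a = σa
  generalize fderiv ℝ (depth c ε) p b = σb
  simp only [Complex.add_re, Complex.add_im, Complex.smul_re, Complex.smul_im, smul_eq_mul,
    Complex.mul_re, Complex.mul_im, Complex.I_re, Complex.I_im]
  intro key
  linear_combination key

theorem injective_fderiv_surface (hs : IsGoodScale c ε δ δ') (hc : IsRegularLoop c)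
    (hφ : ContDiffOn ℝ ∞ φ (Ici 0)) (hφ' : ∀ r : ℝ, 0 ≤ r → φ r ∈ Ioo 0 Real.pi) (p : ℝ × ℝ) :
    Function.Injective (fderiv ℝ (surface c ε φ) p) := by
  rw [injective_iff_map_eq_zero]
  intro a ha
  rw [hs.fderiv_surface hc hφ, Prod.mk_eq_zero] at ha
  obtain ⟨hz, hw⟩ := ha
  replace hw := (mul_eq_zero.1 hw).resolve_left (Complex.exp_ne_zero _)
  have hf0 := hs.fiber_ne_zero hc p
  have hφpos : φ (2 * ‖fiber c ε p‖) ≠ 0 := (hφ' _ (by positivity)).1.ne'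
  -- The rotational part of the velocity is perpendicular to the half chord, so a kernel vector does
  -- not change `|w|` to first order.
  have hdot : dot (fiber c ε p) (dfiber c ε p a) = 0 := by
    rw [add_eq_zero_iff_neg_eq.1 hw |>.symm]
    simp only [dot, Complex.neg_re, Complex.neg_im, Complex.smul_re, Complex.smul_im, smul_eq_mul,
      Complex.mul_re, Complex.mul_im, Complex.I_re, Complex.I_im]
    ring
  obtain ⟨m, hm⟩ := hs.fderiv_phase hc hφ p
  have hP := hm a
  rw [hdot, mul_zero, add_zero] at hP
  -- The sum and the difference of the two equations isolate the velocities of the two end points,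
  -- and `c'` never vanishes.
  have hchord : ∀ X σ : ℝ, X • dsum c p.1 (depth c ε p) + σ • ddiff c p.1 (depth c ε p) = 0 →
      X • ddiff c p.1 (depth c ε p) + σ • dsum c p.1 (depth c ε p) = 0 → X = 0 ∧ σ = 0 := by
    intro X σ h1 h2
    have e1 : ((X + σ : ℝ) : ℂ) * deriv c (p.1 + depth c ε p) = 0 := by
      simp only [dsum, ddiff, Complex.real_smul] at h1 h2
      push_cast
      linear_combination h1 + h2
    have e2 : ((X - σ : ℝ) : ℂ) * deriv c (p.1 - depth c ε p) = 0 := by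
      simp only [dsum, ddiff, Complex.real_smul] at h1 h2
      push_cast
      linear_combination h1 - h2
    have e3 := Complex.ofReal_eq_zero.1 ((mul_eq_zero.1 e1).resolve_right (hc.deriv_ne _))
    have e4 := Complex.ofReal_eq_zero.1 ((mul_eq_zero.1 e2).resolve_right (hc.deriv_ne _))
    constructor <;> linarith
  have hd := hs.fderiv_depth p a
  -- At a turning point of a cap the label is stationary: the direction of `x` must move the
  -- midpoint, and that of `y` must rotate `w`. Elsewhere `(x, y) ↦ (x, s)` is a local
  -- diffeomorphism.
  by_cases hsn : sn p.2 = 0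
  · have htw := deriv_twist_ne_zero hsn
    rw [hsn] at hd
    simp only [mul_zero, zero_mul, add_zero] at hd
    set sx := fderiv ℝ (IsCollar.slice (scaledSq c ε)) (p.1, label p.2) (1, 0) with hsx
    have ha1 : a.1 = 0 := by
      by_contra hne
      obtain ⟨k, -, hk⟩ := hs.exists_dot_dfiber hc htw
      have e1 := hk (1, 0)
      have e2 : fderiv ℝ (depth c ε) p (1, 0) = sx := by
        rw [hs.fderiv_depth]; simp [hsx]
      simp only [dfiber, e2, one_smul, mul_zero] at e1
      have e3 : dsum c p.1 (depth c ε p) + sx • ddiff c p.1 (depth c ε p) = 0 := by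
        rw [hd, mul_smul, ← smul_add] at hz
        exact (smul_eq_zero.1 hz).resolve_left hne
      rcases label_of_deriv_twist_ne_zero htw with h1 | h1
      · have e4 := (hs.collar.slice_of_le p.1 (label_mem p.2).1 (v := label p.2) (by linarith)).2
        have e5 := hs.dot_deriv_pos hc (x := p.1) (u := 0) (s := depth c ε p) (s' := sx)
          (hs.depth_mem p).1 (e4.trans hs.lt) (by simpa using (hs.collar.pos.trans hs.lt))
        rw [add_zero] at e5
        have e6 := e5 e1
        rw [e3] at e6
        simp [dot] at e6
      -- The far collar becomes the near one when the end points are exchanged, which fixes `dsum`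
      -- and changes the signs of `ddiff`, of the half chord and of `s'`.
      · have hl : label (3 / 4 - p.2) ≤ 5 / 4 := by rw [label_reflect]; linarith
        have e4 := (hs.collar.slice_of_le (p.1 + 1 / 2) (label_mem (3 / 4 - p.2)).1 hl).2
        rw [label_reflect, hs.collar.slice_symm] at e4
        have e5 := hs.dot_deriv_pos hc (x := p.1 + 1 / 2) (u := 0) (s := 1 / 2 - depth c ε p)
          (s' := -sx) (by linarith [(hs.depth_mem p).2]) (e4.trans hs.lt)
          (by simpa using (hs.collar.pos.trans hs.lt))
        have r1 : deriv c (p.1 + 1 / 2 + (1 / 2 - depth c ε p)) = deriv c (p.1 - depth c ε p) := by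
          have := hc.deriv_add_int (p.1 - depth c ε p) 1
          rw [← this]
          congr 1
          push_cast
          ring
        have r2 : deriv c (p.1 + 1 / 2 - (1 / 2 - depth c ε p)) = deriv c (p.1 + depth c ε p) := by
          congr 1
          ring
        have r3 : dsum c (p.1 + 1 / 2) (1 / 2 - depth c ε p) = dsum c p.1 (depth c ε p) := by
          rw [dsum, r1, r2, dsum, add_comm]
        have r4 : ddiff c (p.1 + 1 / 2) (1 / 2 - depth c ε p) = -ddiff c p.1 (depth c ε p) := by
          rw [ddiff, r1, r2, ddiff]
          ring
        rw [add_zero, r3, r4, hc.chord_add_half, neg_smul, smul_neg, neg_smul, neg_neg, e3] at e5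
        have e6 := e5 (by
          rw [← e1]
          simp only [fiber, dot, Complex.add_re, Complex.add_im, Complex.neg_re, Complex.neg_im]
          ring)
        simp [dot] at e6
    rw [ha1, zero_mul] at hd
    have e7 : dfiber c ε p a = 0 := by simp [dfiber, ha1, hd]
    rw [e7, add_zero] at hw
    have e8 : fderiv ℝ (phase c ε φ) p a = 0 :=
      (smul_eq_zero.1 hw).resolve_right (mul_ne_zero Complex.I_ne_zero hf0)
    rw [e8] at hP
    have ha2 : a.2 = 0 := by
      have := (mul_eq_zero.1 hP.symm).resolve_right hφpos
      exact (mul_eq_zero.1 this).resolve_left htw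
    exact Prod.ext ha1 ha2
  · have hta : deriv twist p.2 * a.2 = 0 := by
      by_cases htw : deriv twist p.2 = 0
      · rw [htw, zero_mul]
      · obtain ⟨k, hk0, hk⟩ := hs.exists_dot_dfiber hc htw
        rw [hk] at hdot
        rw [(mul_eq_zero.1 hdot).resolve_left (hk0 hsn), mul_zero]
    rw [hta, zero_mul] at hP
    rw [hP, zero_smul, zero_add] at hw
    obtain ⟨ha1, hσ⟩ := hchord _ _ hz hw
    rw [hσ, ha1, zero_mul, zero_add] at hd
    have hne : 5 * √2 / 4 * (2 * Real.pi) * sn p.2 *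
        fderiv ℝ (IsCollar.slice (scaledSq c ε)) (p.1, label p.2) (0, 1) ≠ 0 := by
      refine mul_ne_zero (mul_ne_zero (by positivity) hsn) ?_
      exact hs.collar.fderiv_slice_ne_zero p.1 (label_mem p.2)
    exact Prod.ext ha1 ((mul_eq_zero.1 hd.symm).resolve_right hne)

end IsGoodScale

/-! ### Rotations, descent to the torus, and the neighborhood -/

theorem S_snd_norm (ψ : ℝ → ℝ) (p : ℂ × ℂ) : ‖(S ψ p).2‖ = ‖p.2‖ := by
  rw [S, norm_mul, Complex.norm_exp_ofReal_mul_I, one_mul]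

theorem S_injective (ψ : ℝ → ℝ) : Function.Injective (S ψ) := by
  intro p p' h
  have h1 : (S ψ p).1 = (S ψ p').1 := congrArg Prod.fst h
  have h2 : ‖p.2‖ = ‖p'.2‖ := by rw [← S_snd_norm ψ p, h, S_snd_norm]
  have h3 : (S ψ p).2 = (S ψ p').2 := congrArg Prod.snd h
  simp only [S, h2] at h3
  exact Prod.ext h1 (mul_left_cancel₀ (Complex.exp_ne_zero _) h3)

theorem S_zero : S (fun _ => 0) = id := by
  ext p <;> simp [S]

theorem R_pi (p : ℂ × ℂ) : R Real.pi p = (p.1, -p.2) := by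
  simp [R]

theorem R_pi_image_eq {A : Set (ℂ × ℂ)} (h : ∀ p ∈ A, R Real.pi p ∈ A) : R Real.pi '' A = A := by
  refine Subset.antisymm (image_subset_iff.2 h) fun p hp => ⟨R Real.pi p, h p hp, ?_⟩
  simp [R_pi]

/-- A doubly periodic function descends to the torus. -/
theorem exists_torus_map {F : ℝ × ℝ → ℂ × ℂ} (h1 : ∀ x y, F (x + 1, y) = F (x, y))
    (h2 : ∀ x y, F (x, y + 1) = F (x, y)) : ∃ f : Torus → ℂ × ℂ, lift f = F := by
  have p1 : ∀ y, Function.Periodic (fun x => F (x, y)) 1 := fun y x => h1 x y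
  have p2 : ∀ x, Function.Periodic (fun y => F (x, y)) 1 := fun x y => h2 x y
  have p3 : Function.Periodic (fun x => (p2 x).lift) 1 := by
    intro x
    ext1 q
    induction q using QuotientAddGroup.induction_on with
    | H y => simp only [Function.Periodic.lift_coe, h1]
  refine ⟨fun q => p3.lift q.1 q.2, ?_⟩
  ext1 ⟨x, y⟩
  simp only [lift]
  erw [Function.Periodic.lift_coe, Function.Periodic.lift_coe]

theorem coe_eq_coe_iff {t t' : ℝ} : (t : UnitAddCircle) = t' ↔ ∃ n : ℤ, t' = t + n := by
  rw [eq_comm, ← sub_eq_zero, ← AddCircle.coe_sub, AddCircle.coe_eq_zero_iff]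
  simp only [zsmul_eq_mul, mul_one]
  exact ⟨fun ⟨n, hn⟩ => ⟨n, by linarith⟩, fun ⟨n, hn⟩ => ⟨n, by linarith⟩⟩

theorem mem_annulus {I : Set ℝ} {q : Torus} :
    q ∈ annulus I ↔ ∃ x : ℝ, ∃ y ∈ I, q = ((x : UnitAddCircle), (y : UnitAddCircle)) := by
  constructor
  · rintro ⟨-, y, hy, h⟩
    obtain ⟨x, hx⟩ := QuotientAddGroup.mk_surjective q.1
    exact ⟨x, y, hy, Prod.ext hx.symm h.symm⟩
  · rintro ⟨x, y, hy, rfl⟩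
    exact ⟨mem_univ _, y, hy, rfl⟩

/-- The neighborhood of `γ × {0}` in which the surgery takes place. -/
def tube (γ : Set ℂ) (ε : ℝ) : Set (ℂ × ℂ) := {p | ‖p.2‖ < ε ∧ Metric.infDist p.1 γ < 2 * ε}

theorem isOpen_tube (γ : Set ℂ) (ε : ℝ) : IsOpen (tube γ ε) :=
  (isOpen_lt continuous_snd.norm continuous_const).and
    (isOpen_lt ((Metric.continuous_infDist_pt γ).comp continuous_fst) continuous_const)

theorem subset_tube (γ : Set ℂ) {ε : ℝ} (hε : 0 < ε) : γ ×ˢ {(0 : ℂ)} ⊆ tube γ ε := by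
  rintro ⟨z, w⟩ ⟨hz, hw⟩
  simp only [mem_singleton_iff] at hw
  subst hw
  refine ⟨by simpa using hε, ?_⟩
  rw [Metric.infDist_zero_of_mem hz]
  positivity

theorem R_pi_image_tube (γ : Set ℂ) (ε : ℝ) : R Real.pi '' tube γ ε = tube γ ε :=
  R_pi_image_eq fun p hp => by
    rw [R_pi]
    exact ⟨by simpa using hp.1, hp.2⟩

theorem exists_tube_subset {γ : Set ℂ} (hγ : IsCompact γ) (hne : γ.Nonempty) {U : Set (ℂ × ℂ)}
    (hU : IsOpen U) (h : γ ×ˢ {(0 : ℂ)} ⊆ U) : ∃ ρ > 0, ∀ ε ≤ ρ, tube γ ε ⊆ U := by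
  obtain ⟨ρ, hρ, hsub⟩ := (hγ.prod isCompact_singleton).exists_thickening_subset_open hU h
  refine ⟨ρ / 2, by positivity, fun ε hε p hp => hsub ?_⟩
  obtain ⟨a, ha, hd⟩ := (Metric.infDist_lt_iff hne).1 hp.2
  refine Metric.mem_thickening_iff.2 ⟨(a, 0), ⟨ha, rfl⟩, ?_⟩
  rw [Prod.dist_eq, max_lt_iff]
  refine ⟨by linarith, ?_⟩
  simp only [dist_zero_right]
  linarith [hp.1, norm_nonneg p.2]

namespace IsRegularLoop

variable {c : ℝ → ℂ}

theorem isCompact_range (hc : IsRegularLoop c) : IsCompact (range c) := by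
  have : range c = c '' Icc 0 1 := by
    refine Subset.antisymm ?_ (image_subset_range _ _)
    rintro _ ⟨t, rfl⟩
    refine ⟨Int.fract t, ⟨Int.fract_nonneg t, (Int.fract_lt_one t).le⟩, ?_⟩
    rw [← hc.add_int (Int.fract t) ⌊t⌋, Int.fract_add_floor]
  rw [this]
  exact isCompact_Icc.image hc.contDiff.continuous

theorem mid_chord_mem (c : ℝ → ℂ) (x s : ℝ) : (mid c x s, chord c x s) ∈ torusL (range c) :=
  ⟨(c (x + s), c (x - s)), ⟨mem_range_self _, mem_range_self _⟩, rfl⟩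

/-- The fractional part of `t - t'` is `2 s`; it is nonzero because `w ≠ 0`. -/
theorem exists_mid_chord (hc : IsRegularLoop c) {p : ℂ × ℂ} (hp : p ∈ torusL (range c))
    (h0 : p.2 ≠ 0) : ∃ x, ∃ s ∈ Ioo (0 : ℝ) (1 / 2), p = (mid c x s, chord c x s) := by
  obtain ⟨⟨_, _⟩, ⟨⟨t, rfl⟩, ⟨t', rfl⟩⟩, rfl⟩ := hp
  set n := ⌊t - t'⌋
  have e1 : c (t - n) = c t := by rw [← hc.add_int (t - n) n, sub_add_cancel]
  have e2 : (l (c t, c t')) = (mid c ((t - n + t') / 2) ((t - n - t') / 2),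
      chord c ((t - n + t') / 2) ((t - n - t') / 2)) := by
    have a1 : (t - n + t') / 2 + (t - n - t') / 2 = t - n := by ring
    have a2 : (t - n + t') / 2 - (t - n - t') / 2 = t' := by ring
    rw [mid, chord, a1, a2, e1, l]
  refine ⟨(t - n + t') / 2, (t - n - t') / 2, ⟨?_, ?_⟩, e2⟩
  · have h1 := Int.floor_le (t - t')
    rcases h1.eq_or_lt with h2 | h2
    · exfalso
      apply h0
      have : t - n = t' := by simp only [n]; linarith
      rw [l, ← e1, this]
      simp
    · simp only [n]; linarith
  · have := Int.lt_floor_add_one (t - t')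
    simp only [n]; linarith

/-- Midpoint plus or minus half chord gives the end points, hence integer shifts `n` and `m`; their
difference `2 (s' - s)` lies in `(-1, 1)`, so `n = m`. -/
theorem eq_of_mid_chord (hc : IsRegularLoop c) {x s x' s' : ℝ} (hs : s ∈ Ioo (0 : ℝ) (1 / 2))
    (hs' : s' ∈ Ioo (0 : ℝ) (1 / 2)) (h1 : mid c x s = mid c x' s')
    (h2 : chord c x s = chord c x' s') : s' = s ∧ ∃ n : ℤ, x' = x + n := by
  unfold mid at h1
  unfold chord at h2
  obtain ⟨n, hn⟩ := hc.inj (x + s) (x' + s') (by linear_combination h1 + h2)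
  obtain ⟨m, hm⟩ := hc.inj (x - s) (x' - s') (by linear_combination h1 - h2)
  have e1 : ((n - m : ℤ) : ℝ) = 2 * (s' - s) := by push_cast; linarith
  have e2 : ((n - m : ℤ) : ℝ) < 1 := by rw [e1]; linarith [hs.1, hs'.2]
  have e3 : (-1 : ℝ) < ((n - m : ℤ) : ℝ) := by rw [e1]; linarith [hs.2, hs'.1]
  have e4 : n - m < 1 := by exact_mod_cast e2
  have e5 : -1 < n - m := by exact_mod_cast e3
  have e6 : n - m = 0 := by omega
  rw [e6] at e1
  have e7 : s' = s := by push_cast at e1; linarith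
  exact ⟨e7, n, by rw [e7] at hn; linarith⟩

end IsRegularLoop

/-- The midpoint is at distance `|w|` from the point `c (x + s)` of `γ`, so the condition on `z` is
automatic on rotated copies of `L`. -/
theorem S_mem_tube_iff {c : ℝ → ℂ} {x s ε : ℝ} (ψ : ℝ → ℝ) :
    S ψ (mid c x s, chord c x s) ∈ tube (range c) ε ↔ ‖chord c x s‖ < ε := by
  have h1 : ‖(S ψ (mid c x s, chord c x s)).2‖ = ‖chord c x s‖ := S_snd_norm _ _
  refine ⟨fun h => h1 ▸ h.1, fun h => ⟨h1 ▸ h, ?_⟩⟩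
  change Metric.infDist (mid c x s) (range c) < 2 * ε
  refine (Metric.infDist_le_dist_of_mem (mem_range_self (x + s))).trans_lt ?_
  have : c (x + s) - mid c x s = chord c x s := by
    unfold mid chord
    ring
  rw [dist_comm, dist_eq_norm, this]
  linarith [norm_nonneg (chord c x s)]

theorem surface_eq_S (c : ℝ → ℂ) (ε : ℝ) (φ : ℝ → ℝ) (p : ℝ × ℝ) :
    surface c ε φ p = S (fun r => twist p.2 * φ r)
      (mid c p.1 (depth c ε p), chord c p.1 (depth c ε p)) := rfl

/-! ### The four annuli of the torus -/

namespace IsGoodScale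

variable {c : ℝ → ℂ} {ε δ δ' : ℝ} {φ : ℝ → ℝ}

theorem surface_add_one_left (hs : IsGoodScale c ε δ δ') (hc : IsRegularLoop c) (x y : ℝ) :
    surface c ε φ (x + 1, y) = surface c ε φ (x, y) := by
  simp only [surface, phase, fiber, depth, hs.collar.slice_periodic, hc.mid_add_one,
    hc.chord_add_one]

theorem surface_add_one_right (c : ℝ → ℂ) (ε : ℝ) (φ : ℝ → ℝ) (x y : ℝ) :
    surface c ε φ (x, y + 1) = surface c ε φ (x, y) := by
  simp only [surface, phase, fiber, depth, label_add_one, twist_add_one]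

theorem surface_reflect (hs : IsGoodScale c ε δ δ') (hc : IsRegularLoop c) (x y : ℝ) :
    surface c ε φ (x + 1 / 2, 3 / 4 - y) = R Real.pi (surface c ε φ (x, y)) := by
  simp only [R_pi, surface, phase, fiber, depth, label_reflect, twist_reflect,
    hs.collar.slice_symm, hc.mid_add_half, hc.chord_add_half, norm_neg, mul_neg]

theorem norm_fiber_sq (hs : IsGoodScale c ε δ δ') (p : ℝ × ℝ) :
    ‖fiber c ε p‖ ^ 2 = ε ^ 2 * scaledSq c ε (p.1, depth c ε p) := by
  rw [← hs.chordSq_eq, ← sq_norm_chord, fiber]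

theorem norm_fiber_sq_of_le (hs : IsGoodScale c ε δ δ') {p : ℝ × ℝ} (h : label p.2 ≤ 1) :
    ‖fiber c ε p‖ ^ 2 = ε ^ 2 * label p.2 := by
  rw [hs.norm_fiber_sq, depth, (hs.collar.slice_of_le _ (label_mem _).1 (by linarith)).1]

/-- Serves for both `L` and `L_φ`: on `I` the twist is constant and the label covers `[1, 7/2]`
once, so only the coordinates `(x, s)` of the part `|w| ≥ ε` are being relabelled. -/
theorem bijOn_annulus (hs : IsGoodScale c ε δ δ') (hc : IsRegularLoop c) {f : Torus → ℂ × ℂ}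
    (hf : lift f = surface c ε φ) {I : Set ℝ} {ψ : ℝ → ℝ}
    (hψ : ∀ y ∈ I, (fun r => twist y * φ r) = ψ)
    (hlab : ∀ y ∈ I, label y ∈ Icc (1 : ℝ) (7 / 2))
    (hsurj : ∀ v ∈ Icc (1 : ℝ) (7 / 2), ∃ y ∈ I, label y = v)
    (hinj : ∀ y ∈ I, ∀ y' ∈ I, cs y = cs y' → sn y = sn y') :
    BijOn f (annulus I) (S ψ '' torusL (range c) \ tube (range c) ε) := by
  have hε := hs.pos
  have hf' : ∀ x y : ℝ, f ((x : UnitAddCircle), (y : UnitAddCircle)) = surface c ε φ (x, y) :=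
    fun x y => congrFun hf (x, y)
  have hval : ∀ x : ℝ, ∀ y ∈ I, f ((x : UnitAddCircle), (y : UnitAddCircle)) =
      S ψ (mid c x (depth c ε (x, y)), chord c x (depth c ε (x, y))) := by
    intro x y hy
    rw [hf', surface_eq_S, hψ y hy]
  refine ⟨?_, ?_, ?_⟩
  · intro q hq
    obtain ⟨x, y, hy, rfl⟩ := mem_annulus.1 hq
    rw [hval x y hy]
    refine ⟨mem_image_of_mem _ (IsRegularLoop.mid_chord_mem c _ _), ?_⟩
    rw [S_mem_tube_iff, not_lt]
    have h1 := hs.norm_fiber_sq (x, y)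
    have h2 := hs.collar.one_le_of_slice x (hlab y hy)
    refine le_of_sq_le_sq ?_ (norm_nonneg _)
    change ε ^ 2 ≤ ‖fiber c ε (x, y)‖ ^ 2
    rw [h1]
    change 1 ≤ scaledSq c ε (x, depth c ε (x, y)) at h2
    nlinarith [pow_pos hε 2]
  · intro q hq q' hq' he
    obtain ⟨x, y, hy, rfl⟩ := mem_annulus.1 hq
    obtain ⟨x', y', hy', rfl⟩ := mem_annulus.1 hq'
    rw [hval x y hy, hval x' y' hy'] at he
    have he' := S_injective ψ he
    rw [Prod.mk.injEq] at he'
    obtain ⟨h1, n, h2⟩ := hc.eq_of_mid_chord (hs.depth_mem _) (hs.depth_mem _) he'.1 he'.2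
    subst h2
    have h3 : label y = label y' := by
      refine hs.collar.slice_injective x (label_mem y) (label_mem y') ?_
      rw [depth, depth] at h1
      simp only [hs.collar.slice_add_int] at h1
      exact h1.symm
    have h4 := cs_eq_of_label_eq h3
    rw [Prod.mk.injEq]
    exact ⟨coe_eq_coe_iff.2 ⟨n, rfl⟩,
      coe_eq_coe_iff.2 (eq_add_int_of_cs_sn h4 (hinj y hy y' hy' h4))⟩
  · rintro _ ⟨⟨p, hp, rfl⟩, hN⟩
    -- A point with `w = 0` is a chord with `s = 0`, and lies in the tube.
    have h0 : p.2 ≠ 0 := by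
      intro h0
      obtain ⟨⟨_, _⟩, ⟨⟨t, rfl⟩, ⟨t', rfl⟩⟩, rfl⟩ := hp
      have ht : c t = c t' := by
        simp only [l, div_eq_zero_iff, OfNat.ofNat_ne_zero, or_false] at h0
        exact sub_eq_zero.1 h0
      apply hN
      have : l (c t, c t') = (mid c t 0, chord c t 0) := by
        simp [l, mid, chord, ht]
      rw [this, S_mem_tube_iff]
      simpa [chord] using hε
    obtain ⟨x, s, hsm, rfl⟩ := hc.exists_mid_chord hp h0
    rw [S_mem_tube_iff, not_lt] at hN
    have h1 : 1 ≤ scaledSq c ε (x, s) := by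
      rw [scaledSq, ← sq_norm_chord, one_le_div (by positivity)]
      exact pow_le_pow_left₀ hε.le hN 2
    obtain ⟨v, hv, rfl⟩ := hs.collar.exists_slice_eq hsm h1
    obtain ⟨y, hy, rfl⟩ := hsurj v hv
    exact ⟨_, mem_annulus.2 ⟨x, y, hy, rfl⟩, hval x y hy⟩

/-- The curve of rotated radii is embedded and disjoint from its opposite. -/
theorem eq_of_surface_eq_or_neg (hs : IsGoodScale c ε δ δ') (hc : IsRegularLoop c)
    (hφ' : ∀ r : ℝ, 0 ≤ r → φ r ∈ Ioo 0 Real.pi) {x x' y y' : ℝ}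
    (hy : y ∈ Icc (0 : ℝ) (1 / 4)) (hy' : y' ∈ Icc (0 : ℝ) (1 / 4)) {e : ℝ} (he : e = 1 ∨ e = -1)
    (h1 : (surface c ε φ (x, y)).1 = (surface c ε φ (x', y')).1)
    (h2 : (surface c ε φ (x, y)).2 = e * (surface c ε φ (x', y')).2) :
    e = 1 ∧ (∃ n : ℤ, x' = x + n) ∧ ∃ n : ℤ, y' = y + n := by
  have hε := hs.pos
  have hnorm : ∀ p : ℝ × ℝ, ‖(surface c ε φ p).2‖ = ‖fiber c ε p‖ := fun p => by
    rw [surface_eq_S, S_snd_norm]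
    rfl
  -- On a cap `|w|² = ε² label`, so `w` determines the label up to sign ambiguity of `w`. The
  -- midpoint then determines `x`, and only the angle remains.
  have hlab : label y = label y' := by
    have e1 : ‖fiber c ε (x, y)‖ ^ 2 = ‖fiber c ε (x', y')‖ ^ 2 := by
      rw [← hnorm, ← hnorm, h2, norm_mul]
      rcases he with rfl | rfl <;> simp
    rw [hs.norm_fiber_sq_of_le (label_le_one hy), hs.norm_fiber_sq_of_le (label_le_one hy')] at e1
    exact mul_left_cancel₀ (by positivity) e1
  obtain ⟨n, hn⟩ : ∃ n : ℤ, x' = x + n := by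
    refine hs.mid_slice_injective hc (label_mem y).1 (by linarith [label_le_one hy]) ?_
    conv_rhs => rw [hlab]
    exact h1
  have hfib : fiber c ε (x', y') = fiber c ε (x, y) := by
    have hper : ∀ s, chord c (x + n) s = chord c x s := by
      intro s
      rw [chord, chord, add_right_comm, hc.add_int, ← hc.add_int (x - s) n, sub_add_eq_add_sub]
    rw [fiber, fiber, depth, depth]
    simp only [hn, hs.collar.slice_add_int, hper, hlab]
  have hfib0 := hs.fiber_ne_zero hc (x, y)
  set Φ := φ (2 * ‖fiber c ε (x, y)‖) with hΦ
  have hΦm : Φ ∈ Ioo 0 Real.pi := hφ' _ (by positivity)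
  have hexp : Complex.exp ((twist y * Φ : ℝ) * Complex.I) =
      e * Complex.exp ((twist y' * Φ : ℝ) * Complex.I) := by
    have e1 : (surface c ε φ (x', y')).2 =
        Complex.exp ((twist y' * Φ : ℝ) * Complex.I) * fiber c ε (x, y) := by
      simp only [surface, phase, hfib, hΦ]
    rw [e1, ← mul_assoc] at h2
    exact mul_right_cancel₀ hfib0 h2
  have hrange : ∀ y, twist y * Φ ∈ Ico 0 Real.pi := fun y =>
    ⟨mul_nonneg (twist_mem y).1 hΦm.1.le,
      (mul_le_of_le_one_left hΦm.1.le (twist_mem y).2).trans_lt hΦm.2⟩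
  have hre := congrArg Complex.re hexp
  have him := congrArg Complex.im hexp
  rw [Complex.re_ofReal_mul, Complex.exp_ofReal_mul_I_re, Complex.exp_ofReal_mul_I_re] at hre
  rw [Complex.im_ofReal_mul, Complex.exp_ofReal_mul_I_im, Complex.exp_ofReal_mul_I_im] at him
  have ha := hrange y
  have ha' := hrange y'
  rcases he with rfl | rfl
  · rw [one_mul] at hre
    have e1 := Real.injOn_cos (Ico_subset_Icc_self ha) (Ico_subset_Icc_self ha') hre
    have e2 : twist y = twist y' := mul_right_cancel₀ hΦm.1.ne' e1
    exact ⟨rfl, ⟨n, hn⟩, eq_add_int_of_cs_sn (cs_eq_of_label_eq hlab)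
      (sn_eq_of_twist_eq (le_cs hy) (le_cs hy') e2)⟩
  -- Opposite unit vectors with angles in `[0, π)` have both sines zero, hence both angles zero, and
  -- then the cosines would give `1 = -1`.
  · exfalso
    have e1 := Real.sin_nonneg_of_nonneg_of_le_pi ha.1 ha.2.le
    have e2 := Real.sin_nonneg_of_nonneg_of_le_pi ha'.1 ha'.2.le
    have hzero : ∀ t ∈ Ico 0 Real.pi, Real.sin t = 0 → t = 0 := by
      intro t ht h0
      by_contra hne
      exact (Real.sin_pos_of_pos_of_lt_pi (lt_of_le_of_ne ht.1 (Ne.symm hne)) ht.2).ne' h0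
    have e3 := hzero _ ha (by linarith)
    have e4 := hzero _ ha' (by linarith)
    rw [e3, e4] at hre
    norm_num at hre

/-- The second cap is `R_π` of the first, by `(x, y) ↦ (x + 1/2, 3/4 - y)`. Every comparison is thus
between two points of the first cap, up to a sign on `w`. -/
theorem injOn_annulus (hs : IsGoodScale c ε δ δ') (hc : IsRegularLoop c)
    (hφ' : ∀ r : ℝ, 0 ≤ r → φ r ∈ Ioo 0 Real.pi) {f : Torus → ℂ × ℂ}
    (hf : lift f = surface c ε φ) :
    InjOn f (annulus (Icc 0 (1 / 4) ∪ Icc (1 / 2) (3 / 4))) := by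
  have hf' : ∀ x y : ℝ, f ((x : UnitAddCircle), (y : UnitAddCircle)) = surface c ε φ (x, y) :=
    fun x y => congrFun hf (x, y)
  have hrefl : ∀ x y : ℝ, (surface c ε φ (x, y)).1 = (surface c ε φ (x + 1 / 2, 3 / 4 - y)).1 ∧
      (surface c ε φ (x, y)).2 = -(surface c ε φ (x + 1 / 2, 3 / 4 - y)).2 := by
    intro x y
    rw [hs.surface_reflect hc, R_pi]
    simp
  have hmem : ∀ y ∈ Icc (1 / 2 : ℝ) (3 / 4), 3 / 4 - y ∈ Icc (0 : ℝ) (1 / 4) :=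
    fun y hy => ⟨by linarith [hy.2], by linarith [hy.1]⟩
  intro q hq q' hq' he
  obtain ⟨x, y, hy, rfl⟩ := mem_annulus.1 hq
  obtain ⟨x', y', hy', rfl⟩ := mem_annulus.1 hq'
  rw [hf', hf'] at he
  have he1 := congrArg Prod.fst he
  have he2 := congrArg Prod.snd he
  obtain ⟨r1, r2⟩ := hrefl x y
  obtain ⟨r1', r2'⟩ := hrefl x' y'
  rw [Prod.mk.injEq, coe_eq_coe_iff, coe_eq_coe_iff]
  rcases hy with hy | hy <;> rcases hy' with hy' | hy'
  · exact (hs.eq_of_surface_eq_or_neg hc hφ' hy hy' (.inl rfl) he1 (by simpa using he2)).2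
  · have := (hs.eq_of_surface_eq_or_neg hc hφ' hy (hmem y' hy') (.inr rfl) (he1.trans r1')
      (by rw [he2, r2']; simp)).1
    norm_num at this
  · have := (hs.eq_of_surface_eq_or_neg hc hφ' (hmem y hy) hy' (.inr rfl) (r1.symm.trans he1)
      (by rw [← he2, r2]; simp)).1
    norm_num at this
  · obtain ⟨-, ⟨n, hn⟩, ⟨m, hm⟩⟩ := hs.eq_of_surface_eq_or_neg hc hφ' (hmem y hy) (hmem y' hy')
      (.inl rfl) (r1.symm.trans (he1.trans r1')) (by rw [r2, r2'] at he2; simpa using he2)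
    refine ⟨⟨n, by linarith⟩, ⟨-m, ?_⟩⟩
    push_cast
    linarith

theorem mapsTo_tube (hs : IsGoodScale c ε δ δ') (hc : IsRegularLoop c) {f : Torus → ℂ × ℂ}
    (hf : lift f = surface c ε φ) :
    MapsTo f (annulus (Ioo 0 (1 / 4) ∪ Ioo (1 / 2) (3 / 4))) (tube (range c) ε) := by
  have hε := hs.pos
  have hmem : ∀ x, ∀ y ∈ Ioo (0 : ℝ) (1 / 4), surface c ε φ (x, y) ∈ tube (range c) ε := by
    intro x y hy
    rw [surface_eq_S, S_mem_tube_iff]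
    refine lt_of_pow_lt_pow_left₀ 2 hε.le ?_
    change ‖fiber c ε (x, y)‖ ^ 2 < ε ^ 2
    have h1 := label_lt_one hy
    rw [hs.norm_fiber_sq_of_le (p := (x, y)) h1.le]
    change ε ^ 2 * label y < ε ^ 2
    nlinarith [pow_pos hε 2]
  intro q hq
  obtain ⟨x, y, hy, rfl⟩ := mem_annulus.1 hq
  rw [show f ((x : UnitAddCircle), (y : UnitAddCircle)) = surface c ε φ (x, y) from
    congrFun hf (x, y)]
  rcases hy with hy | hy
  · exact hmem x y hy
  · have h1 := hmem (x + 1 / 2) (3 / 4 - y) ⟨by linarith [hy.2], by linarith [hy.1]⟩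
    rw [hs.surface_reflect hc, R_pi] at h1
    exact ⟨by simpa using h1.1, h1.2⟩

end IsGoodScale

/-- The arcs `[1/4, 1/2]` and `[3/4, 1]` each keep to one side of `sn = 0`, so on them the label
determines `y`. -/
theorem sn_eq_of_cs_eq {y y' : ℝ} (hpos : 0 ≤ sn y * sn y') (h : cs y = cs y') : sn y = sn y' := by
  have h1 := cs_sq_add_sn_sq y
  have h2 := cs_sq_add_sn_sq y'
  have h3 : (sn y - sn y') * (sn y + sn y') = 0 := by
    rw [h] at h1
    linear_combination h1 - h2
  rcases mul_eq_zero.1 h3 with h4 | h4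
  · linarith
  · have h5 : sn y' = -sn y := by linarith
    rw [h5] at hpos
    have h6 : sn y = 0 := by nlinarith
    rw [h5, h6, neg_zero]

/-! ### Assembly -/

/-- The surgery for a rotation by an angle that may depend on the radius. -/
theorem exists_surgery {c : ℝ → ℂ} (hc : IsRegularLoop c) {φ : ℝ → ℝ}
    (hφ : ContDiffOn ℝ ∞ φ (Ici 0)) (hφ' : ∀ r : ℝ, 0 ≤ r → φ r ∈ Ioo 0 Real.pi)
    (U : Set (ℂ × ℂ)) (hU : IsOpen U) (hγU : range c ×ˢ {(0 : ℂ)} ⊆ U) :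
    ∃ (N : Set (ℂ × ℂ)) (f : Torus → ℂ × ℂ),
      IsOpen N ∧ range c ×ˢ {(0 : ℂ)} ⊆ N ∧ N ⊆ U ∧ R Real.pi '' N = N ∧
      IsLagrangianImmersion f ∧
      BijOn f (annulus (Icc (1 / 4) (1 / 2))) (torusL (range c) \ N) ∧
      BijOn f (annulus (Icc (3 / 4) 1)) (S φ '' torusL (range c) \ N) ∧
      MapsTo f (annulus (Ioo 0 (1 / 4) ∪ Ioo (1 / 2) (3 / 4))) N ∧
      InjOn f (annulus (Icc 0 (1 / 4) ∪ Icc (1 / 2) (3 / 4))) ∧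
      R Real.pi '' range f = range f ∧
      Disjoint (range f) (univ ×ˢ {(0 : ℂ)}) := by
  obtain ⟨δ, δ', ε₀, hε₀, hgood⟩ := hc.exists_isGoodScale
  obtain ⟨ρ, hρ, hsub⟩ := exists_tube_subset hc.isCompact_range (range_nonempty c) hU hγU
  set ε := min ε₀ ρ
  have hε : 0 < ε := lt_min hε₀ hρ
  have hs := hgood ε hε (min_le_left _ _)
  obtain ⟨f, hf⟩ := exists_torus_map (hs.surface_add_one_left (φ := φ) hc)
    (IsGoodScale.surface_add_one_right c ε φ)
  have hrange : range f = range (surface c ε φ) := by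
    rw [← hf]
    refine Subset.antisymm ?_ ?_
    · rintro _ ⟨⟨q1, q2⟩, rfl⟩
      obtain ⟨x, rfl⟩ := QuotientAddGroup.mk_surjective q1
      obtain ⟨y, rfl⟩ := QuotientAddGroup.mk_surjective q2
      exact ⟨(x, y), rfl⟩
    · rintro _ ⟨p, rfl⟩
      exact ⟨_, rfl⟩
  have hsqrt : 0 < √2 := by positivity
  refine ⟨tube (range c) ε, f, isOpen_tube _ _, subset_tube _ hε, hsub ε (min_le_right _ _),
    R_pi_image_tube _ _, ⟨?_, ?_, ?_⟩, ?_, ?_, hs.mapsTo_tube hc hf, hs.injOn_annulus hc hφ' hf,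
    ?_, ?_⟩
  · rw [hf]; exact hs.contDiff_surface hc hφ
  · rw [hf]; exact hs.injective_fderiv_surface hc hφ hφ'
  · rw [hf]; exact hs.omega_fderiv_surface hc hφ
  · have := hs.bijOn_annulus hc hf (I := Icc (1 / 4) (1 / 2)) (ψ := fun _ => 0)
      (fun y hy => by simp [twist_of_le_sn (le_sn hy)])
      (fun y hy => label_mem_of_le_abs_sn ((le_sn hy).trans (le_abs_self _)))
      (fun v hv => exists_label_eq_left hv)
      (fun y hy y' hy' h => sn_eq_of_cs_eq
        (mul_nonneg (by linarith [le_sn hy]) (by linarith [le_sn hy'])) h)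
    rwa [S_zero, image_id] at this
  · exact hs.bijOn_annulus hc hf (I := Icc (3 / 4) 1) (ψ := φ)
      (fun y hy => by simp [twist_of_sn_le (sn_le hy)])
      (fun y hy => label_mem_of_le_abs_sn
        ((show √2 / 2 ≤ -sn y by linarith [sn_le hy]).trans (neg_le_abs _)))
      (fun v hv => exists_label_eq_right hv)
      (fun y hy y' hy' h => sn_eq_of_cs_eq
        (mul_nonneg_of_nonpos_of_nonpos (by linarith [sn_le hy]) (by linarith [sn_le hy'])) h)
  · rw [hrange]
    refine R_pi_image_eq ?_
    rintro _ ⟨⟨x, y⟩, rfl⟩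
    exact ⟨(x + 1 / 2, 3 / 4 - y), hs.surface_reflect hc x y⟩
  · rw [hrange, disjoint_left]
    rintro _ ⟨p, rfl⟩ ⟨-, h⟩
    exact mul_ne_zero (Complex.exp_ne_zero _) (hs.fiber_ne_zero hc p) h

theorem isRegularLoop_of_embedding {c : UnitAddCircle → ℂ} (hinj : Function.Injective c)
    (hsm : ContDiff ℝ ∞ (fun t : ℝ => c (t : UnitAddCircle)))
    (hd : ∀ t : ℝ, deriv (fun t : ℝ => c (t : UnitAddCircle)) t ≠ 0) :
    IsRegularLoop (fun t : ℝ => c (t : UnitAddCircle)) where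
  contDiff := hsm
  periodic t := congrArg c (coe_eq_coe_iff.2 ⟨-1, by push_cast; ring⟩)
  deriv_ne := hd
  inj _ _ h := coe_eq_coe_iff.1 (hinj h)

end RectPeg

end

/-- The torus is cut into four consecutive annuli. The second and the fourth one parametrize
what is left of `L` and of `Lφ` once the neighborhood `N` of `γ × {0}` is removed; the first and the
third one are the two disjoint embedded Lagrangian annuli that are glued in, inside `N`. -/
theorem mainTheorem3 (γ : Set ℂ) (hγ : RectPeg.IsSmoothJordanCurve γ)
    (Lφ : Set (ℂ × ℂ)) (hLφ : RectPeg.IsRotatedTorus γ Lφ)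
    (U : Set (ℂ × ℂ)) (hU : IsOpen U) (hγU : γ ×ˢ {(0 : ℂ)} ⊆ U) :
    ∃ (N : Set (ℂ × ℂ)) (f : RectPeg.Torus → ℂ × ℂ),
      IsOpen N ∧ γ ×ˢ {(0 : ℂ)} ⊆ N ∧ N ⊆ U ∧ RectPeg.R Real.pi '' N = N ∧
      RectPeg.IsLagrangianImmersion f ∧
      Set.BijOn f (RectPeg.annulus (Set.Icc (1 / 4) (1 / 2))) (RectPeg.torusL γ \ N) ∧
      Set.BijOn f (RectPeg.annulus (Set.Icc (3 / 4) 1)) (Lφ \ N) ∧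
      Set.MapsTo f (RectPeg.annulus (Set.Ioo 0 (1 / 4) ∪ Set.Ioo (1 / 2) (3 / 4))) N ∧
      Set.InjOn f (RectPeg.annulus (Set.Icc 0 (1 / 4) ∪ Set.Icc (1 / 2) (3 / 4))) ∧
      RectPeg.R Real.pi '' Set.range f = Set.range f ∧
      Disjoint (Set.range f) (Set.univ ×ˢ {(0 : ℂ)}) := by
  obtain ⟨c, hinj, hsm, hd, hr⟩ := hγ
  have hc := RectPeg.isRegularLoop_of_embedding hinj hsm hd
  have hr' : Set.range (fun t : ℝ => c (t : UnitAddCircle)) = γ := by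
    rw [← hr]
    exact (QuotientAddGroup.mk_surjective (s := AddSubgroup.zmultiples (1 : ℝ))).range_comp c
  subst hr'
  rcases hLφ with ⟨φ, h0, h1, rfl⟩ | ⟨φ, h0, h1, rfl⟩
  -- `R φ` is `S` of the constant function by definition, so the constant angle is a special case;
  -- only `φ < π` is used.
  · exact RectPeg.exists_surgery hc (φ := fun _ => φ) contDiffOn_const
      (fun _ _ => ⟨h0, by linarith [Real.pi_pos]⟩) U hU hγU
  · exact RectPeg.exists_surgery hc h0 h1 U hU hγU
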